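/- Let $A$ be a commutative ring, $n\ge 0$, $S=A[x_0,\dots,x_n]$, let $f\in S$ be a nonzerodivisor, and let $R=S/fS$. Write $R\otimes_A S=R[y_0,\dots,y_n]$ with $y_i=1\otimes x_i$ and $x_i=x_i\otimes 1$, put $f(y)=1\otimes f$, and assume that $f(y)$ is a nonzerodivisor on $R\otimes_A S$, i.e. that $$0\longrightarrow R\otimes_A S\xrightarrow{\,f(y)\,}R\otimes_A S\longrightarrow R\otimes_A R\longrightarrow 0$$ is exact. Let $\Delta$ be the kernel of the multiplication map $R\otimes_A R\to R$, and let $D_{R|A}\subseteq\operatorname{End}_A(R)$ be the ring of $A$-linear differential operators on $R$. Then $\Delta$ is generated by the images of $y_0-x_0,\dots,y_n-x_n$. Let $H^n_\Delta(R\otimes_A R)$ be the $n$-th cohomology of the Čech complex of $R\otimes_A R$ on these generators, a $D_{R|A}$-module in which $\delta$ acts on each localization of $R\otimes_A R$ by the unique differential operator extending $\delta\otimes\mathrm{id}$. Then $H^n_\Delta(R\otimes_A R)$ is a free $D_{R|A}$-module of rank one. More precisely, there is an isomorphism of left $D_{R|A}$-modules $e\colon H^n_\Delta(R\otimes_A R)\to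 D_{R|A}$ described as follows. Let $c$ be a Čech $n$-cocycle over $R\otimes_A R$. Then there are a Čech $n$-cochain $c'$ over $R\otimes_A S$ (on the elements $y_i-x_i$) lifting $c$, an integer $N\ge 0$ and an element $p\in R\otimes_A S$ with $$d c'=f(y)\cdot\frac{p}{\prod_{i=0}^n(y_i-x_i)^{N+1}},$$ so that the connecting homomorphism of the sequence above sends $[c]$ to the class of $p/\prod_i(y_i-x_i)^{N+1}$ in $H^{n+1}_{(y_0-x_0,\dots,y_n-x_n)}(R\otimes_A S)$. For every such choice of $c'$, $N$, $p$ and every $g\in S$, the value of the operator $e([c])$ at the class $\bar g\in R$ is the coefficient of $\prod_i(y_i-x_i)^N$ in $p\cdot(1\otimes g)$, written as a polynomial in $y_0-x_0,\dots,y_n-x_n$ with coefficients in $R$. -/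

import Mathlib

open scoped TensorProduct

namespace HypersurfaceDiff

/-! ## Differential operators -/

section DiffOp

variable {A T M N : Type*} [CommRing A] [CommRing T] [Algebra A T]
  [AddCommGroup M] [Module A M] [Module T M] [IsScalarTower A T M]
  [AddCommGroup N] [Module A N] [Module T N] [IsScalarTower A T N]

/-- The commutator `[t, δ] = t ∘ δ - δ ∘ t` of an `A`-linear map `δ : M → N` with
multiplication by `t`. -/
def commutator (t : T) (δ : M →ₗ[A] N) : M →ₗ[A] N :=
  t • δ - δ ∘ₗ Algebra.lsmul A A M t

@[simp] theorem commutator_apply (t : T) (δ : M →ₗ[A] N) (m : M) :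
    commutator t δ m = t • δ m - δ (t • m) := rfl

variable (T) in
/-- `OrderLT T n δ`: the `A`-linear map `δ : M → N` of `T`-modules is a differential operator of
order `< n`, that is of order at most `n - 1`. Only `0` has order `< 0`, and `δ` has order
`< n + 1` when all commutators `[t, δ]` have order `< n`. (Order `< 1` means `T`-linear; for
`M = N = T` these are the multiplications by elements of `T`.) -/
def OrderLT : ℕ → (M →ₗ[A] N) → Prop
  | 0, δ => δ = 0
  | n + 1, δ => ∀ t : T, OrderLT n (commutator t δ)

theorem OrderLT.zero (n : ℕ) : OrderLT T n (0 : M →ₗ[A] N) := by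
  induction n with
  | zero => rfl
  | succ n ih =>
    intro t
    have : commutator t (0 : M →ₗ[A] N) = 0 := by ext; simp
    rw [this]; exact ih

theorem OrderLT.succ {n : ℕ} : ∀ {δ : M →ₗ[A] N}, OrderLT T n δ → OrderLT T (n + 1) δ := by
  induction n with
  | zero =>
    intro δ h t
    obtain rfl : δ = 0 := h
    exact OrderLT.zero (n := 1) t
  | succ n ih => intro δ h t; exact ih (h t)

theorem OrderLT.mono {m n : ℕ} (hmn : m ≤ n) {δ : M →ₗ[A] N} (h : OrderLT T m δ) :
    OrderLT T n δ := by
  induction hmn with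
  | refl => exact h
  | step _ ih => exact ih.succ

theorem OrderLT.add {n : ℕ} : ∀ {δ ε : M →ₗ[A] N},
    OrderLT T n δ → OrderLT T n ε → OrderLT T n (δ + ε) := by
  induction n with
  | zero => intro δ ε h k; rw [OrderLT] at *; simp [h, k]
  | succ n ih =>
    intro δ ε h k t
    have : commutator t (δ + ε) = commutator t δ + commutator t ε := by
      ext; simp; abel
    rw [this]; exact ih (h t) (k t)

theorem OrderLT.sub {n : ℕ} : ∀ {δ ε : M →ₗ[A] N},
    OrderLT T n δ → OrderLT T n ε → OrderLT T n (δ - ε) := by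
  induction n with
  | zero => intro δ ε h k; rw [OrderLT] at *; simp [h, k]
  | succ n ih =>
    intro δ ε h k t
    have : commutator t (δ - ε) = commutator t δ - commutator t ε := by
      ext; simp [smul_sub]; abel
    rw [this]; exact ih (h t) (k t)

/-- Postcomposition with a `T`-linear map preserves the order. -/
theorem OrderLT.post {n : ℕ} {N' : Type*} [AddCommGroup N'] [Module A N'] [Module T N']
    [IsScalarTower A T N'] (g : N →ₗ[A] N') (hg : ∀ (t : T) (x : N), g (t • x) = t • g x) :
    ∀ {δ : M →ₗ[A] N}, OrderLT T n δ → OrderLT T n (g ∘ₗ δ) := by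
  induction n with
  | zero => intro δ h; rw [OrderLT] at *; simp [h]
  | succ n ih =>
    intro δ h t
    have : commutator t (g ∘ₗ δ) = g ∘ₗ commutator t δ := by
      ext; simp [hg]
    rw [this]; exact ih (h t)

/-- Precomposition with a `T`-linear map preserves the order. -/
theorem OrderLT.pre {n : ℕ} {M' : Type*} [AddCommGroup M'] [Module A M'] [Module T M']
    [IsScalarTower A T M'] (g : M' →ₗ[A] M) (hg : ∀ (t : T) (x : M'), g (t • x) = t • g x) :
    ∀ {δ : M →ₗ[A] N}, OrderLT T n δ → OrderLT T n (δ ∘ₗ g) := by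
  induction n with
  | zero => intro δ h; rw [OrderLT] at *; simp [h]
  | succ n ih =>
    intro δ h t
    have : commutator t (δ ∘ₗ g) = commutator t δ ∘ₗ g := by
      ext; simp [hg]
    rw [this]; exact ih (h t)

theorem OrderLT.comp {M' : Type*} [AddCommGroup M'] [Module A M'] [Module T M']
    [IsScalarTower A T M'] (k : ℕ) : ∀ {m n : ℕ} {δ : M →ₗ[A] N} {ε : M' →ₗ[A] M}, m + n = k →
    OrderLT T m δ → OrderLT T n ε → OrderLT T k (δ ∘ₗ ε) := by
  induction k with
  | zero =>
    intro m n δ ε hk h h'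
    obtain rfl : m = 0 := by omega
    rw [OrderLT] at h ⊢
    simp [h]
  | succ k ih =>
    intro m n δ ε hk h h'
    cases m with
    | zero =>
      obtain rfl : δ = 0 := h
      simpa using OrderLT.zero _
    | succ m =>
      cases n with
      | zero =>
        obtain rfl : ε = 0 := h'
        simpa using OrderLT.zero _
      | succ n =>
        intro t
        have : commutator t (δ ∘ₗ ε) = commutator t δ ∘ₗ ε + δ ∘ₗ commutator t ε := by
          ext; simp
        rw [this]
        exact (ih (by omega) (h t) h').add (ih (by omega) h (h' t))

variable (A T M) in
/-- The `A`-linear differential operators `M → M`, as a subring of `End_A(M)` (the product is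
composition). For `M = T = R` this is the ring `D_{R|A}`. -/
def diffOps : Subring (Module.End A M) where
  carrier := {δ | ∃ n, OrderLT T n δ}
  mul_mem' := by
    rintro δ ε ⟨m, hm⟩ ⟨n, hn⟩
    exact ⟨m + n, OrderLT.comp _ rfl hm hn⟩
  add_mem' := by
    rintro δ ε ⟨m, hm⟩ ⟨n, hn⟩
    exact ⟨max m n, (hm.mono (le_max_left _ _)).add (hn.mono (le_max_right _ _))⟩
  one_mem' := by
    refine ⟨1, fun t => ?_⟩
    change commutator t _ = 0
    ext m
    simp
  zero_mem' := ⟨0, rfl⟩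
  neg_mem' := by
    rintro δ ⟨n, hn⟩
    refine ⟨n, ?_⟩
    simpa using (OrderLT.zero n).sub hn

/-! ### Extension of differential operators to localizations -/

/-- If a differential operator out of a localization vanishes on the image of `T`, and the target
has no torsion with respect to the denominators, then it is zero. -/
theorem OrderLT.eq_zero_of_localization {L : Type*} [CommRing L] [Algebra T L] [Algebra A L]
    [IsScalarTower A T L] (W : Submonoid T) [IsLocalization W L]
    (hN : ∀ w ∈ W, ∀ x : N, w • x = 0 → x = 0) {n : ℕ} :
    ∀ {δ : L →ₗ[A] N}, OrderLT T n δ → (∀ t : T, δ (algebraMap T L t) = 0) → δ = 0 := by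
  induction n with
  | zero => intro δ h _; exact h
  | succ n ih =>
    intro δ h h0
    ext x
    obtain ⟨⟨t, w⟩, hx⟩ := IsLocalization.surj W x
    have h1 : commutator (w : T) δ = 0 := by
      refine ih (h w) fun s => ?_
      simp [h0, Algebra.smul_def, ← map_mul]
    have h2 := LinearMap.congr_fun h1 x
    simp only [commutator_apply, LinearMap.zero_apply, Algebra.smul_def (w : T) x] at h2
    rw [mul_comm, hx, h0, sub_zero] at h2
    exact hN _ w.2 _ h2

theorem OrderLT.eq_zero_of_mul {w : T} (hN : ∀ x : N, w • x = 0 → x = 0) {n : ℕ} :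
    ∀ {ε : M →ₗ[A] N}, OrderLT T n ε → (∀ m, ε (w • m) = 0) → ε = 0 := by
  induction n with
  | zero => intro ε h _; exact h
  | succ n ih =>
    intro ε h h0
    have h1 : commutator w ε = 0 := by
      refine ih (h w) fun m => ?_
      simp [h0]
    ext m
    have h2 := LinearMap.congr_fun h1 m
    simp only [commutator_apply, LinearMap.zero_apply, h0, sub_zero] at h2
    exact hN _ h2

theorem OrderLT.exists_div {w : T} (v : N →ₗ[A] N) (hv : ∀ (t : T) (x : N), v (t • x) = t • v x)
    (hwv : ∀ x, v (w • x) = x) {n : ℕ} :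
    ∀ {δ : M →ₗ[A] N}, OrderLT T n δ → ∃ ε : M →ₗ[A] N, OrderLT T n ε ∧ ∀ m, ε (w • m) = δ m := by
  induction n with
  | zero =>
    intro δ h
    obtain rfl : δ = 0 := h
    exact ⟨0, rfl, by simp⟩
  | succ n ih =>
    intro δ h
    obtain ⟨ε, hε, hε'⟩ := ih (OrderLT.post v hv (h w))
    refine ⟨v ∘ₗ δ + ε, (OrderLT.post v hv h).add hε.succ, fun m => ?_⟩
    simp [hε', hwv]

/-- Every differential operator on `T` extends to a differential operator on a localization. -/
theorem OrderLT.exists_extension {L : Type*} [CommRing L] [Algebra T L] [Algebra A L]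
    [IsScalarTower A T L] (W : Submonoid T) [IsLocalization W L] {n : ℕ} {δ : T →ₗ[A] L}
    (hδ : OrderLT T n δ) :
    ∃ δ' : L →ₗ[A] L, OrderLT T n δ' ∧ ∀ t, δ' (algebraMap T L t) = δ t := by
  have hu : ∀ w : W, IsUnit (algebraMap T L w) := fun w => IsLocalization.map_units L w
  have hinj : ∀ w ∈ W, ∀ x : L, w • x = 0 → x = 0 := by
    intro w hw x hx
    rw [Algebra.smul_def] at hx
    exact (hu ⟨w, hw⟩).mul_right_eq_zero.mp hx
  have hdiv : ∀ w : W, ∃ ε : T →ₗ[A] L, OrderLT T n ε ∧ ∀ t, ε (w • t) = δ t := by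
    intro w
    obtain ⟨u, hw⟩ := hu w
    refine OrderLT.exists_div (Algebra.lsmul A A L (↑u⁻¹ : L)) ?_ ?_ hδ
    · intro t x
      simp [Algebra.smul_def]; ring
    · intro x
      simp [Algebra.smul_def, ← hw]
  choose ε hε hε' using hdiv
  -- independence of the chosen fraction
  have hmul : ∀ (v w : W) (t : T), ε (v * w) (v • t) = ε w t := by
    intro v w t
    have h0 : ε (v * w) ∘ₗ Algebra.lsmul A A T (v : T) - ε w = 0 := by
      refine OrderLT.eq_zero_of_mul (w := (w : T)) (hinj w w.2) (n := n) ?_ ?_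
      · refine OrderLT.sub (OrderLT.pre _ ?_ (hε _)) (hε _)
        intro s x
        simp only [Algebra.lsmul_coe, smul_eq_mul]; ring
      · intro m
        have h1 := hε' (v * w) m
        have h2 := hε' w m
        simp only [Submonoid.smul_def, Submonoid.coe_mul, smul_eq_mul] at h1 h2
        simp only [LinearMap.sub_apply, LinearMap.comp_apply, Algebra.lsmul_coe, smul_eq_mul]
        rw [← mul_assoc, h1, h2, sub_self]
    have := LinearMap.congr_fun h0 t
    simpa [sub_eq_zero, Submonoid.smul_def] using this
  have hwd : ∀ (v w : W) (s t : T) (x : L), x * algebraMap T L v = algebraMap T L s →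
      x * algebraMap T L w = algebraMap T L t → ε v s = ε w t := by
    intro v w s t x hv hw
    have h1 : algebraMap T L (w * s) = algebraMap T L (v * t) := by
      rw [map_mul, map_mul, ← hv, ← hw]; ring
    obtain ⟨u, hu'⟩ := (IsLocalization.eq_iff_exists W L).mp h1
    have e1 := hmul (u * w) v s
    have e2 := hmul (u * v) w t
    rw [← e1, ← e2, mul_right_comm u w v]
    congr 1
    simp only [Submonoid.smul_def, Submonoid.coe_mul, smul_eq_mul]
    rw [mul_assoc, mul_assoc, hu']
  choose num hnum using fun x : L => IsLocalization.surj W x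
  let F : L → L := fun x => ε (num x).2 (num x).1
  have hF : ∀ (x : L) (w : W) (t : T), x * algebraMap T L w = algebraMap T L t → F x = ε w t :=
    fun x w t h => hwd _ _ _ _ x (hnum x) h
  let δ' : L →ₗ[A] L :=
    { toFun := F
      map_add' := by
        intro x y
        obtain ⟨⟨s, v⟩, hx⟩ := IsLocalization.surj W x
        obtain ⟨⟨t, w⟩, hy⟩ := IsLocalization.surj W y
        dsimp only at hx hy
        rw [hF x (v * w) (w * s) (by rw [Submonoid.coe_mul, map_mul, map_mul, ← hx]; ring),
          hF y (v * w) (v * t) (by rw [Submonoid.coe_mul, map_mul, map_mul, ← hy]; ring),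
          hF (x + y) (v * w) (w * s + v * t)
            (by rw [Submonoid.coe_mul, map_add, map_mul, map_mul, map_mul, ← hx, ← hy]; ring), map_add]
      map_smul' := by
        intro a x
        obtain ⟨⟨s, v⟩, hx⟩ := IsLocalization.surj W x
        dsimp only at hx
        rw [hF x v s hx, hF (a • x) v (a • s)
          (by rw [smul_mul_assoc, hx, Algebra.smul_def a s, map_mul,
            ← IsScalarTower.algebraMap_apply, ← Algebra.smul_def]), map_smul]
        rfl }
  refine ⟨δ', ?_, fun t => ?_⟩
  · -- the order is at most that of `δ`
    have key : ∀ (n : ℕ) (η : L →ₗ[A] L),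
        (∀ w : W, ∃ θ : T →ₗ[A] L, OrderLT T n θ ∧
          ∀ x t, x * algebraMap T L w = algebraMap T L t → η x = θ t) → OrderLT T n η := by
      intro n
      induction n with
      | zero =>
        intro η h
        ext x
        obtain ⟨⟨s, v⟩, hx⟩ := IsLocalization.surj W x
        obtain ⟨θ, hθ, h'⟩ := h v
        obtain rfl : θ = 0 := hθ
        exact h' x s hx
      | succ n ih =>
        intro η h t
        refine ih _ fun w => ?_
        obtain ⟨θ, hθ, h'⟩ := h w
        refine ⟨commutator t θ, hθ t, fun x s hx => ?_⟩
        rw [commutator_apply, commutator_apply, h' x s hx, h' (t • x) (t • s)]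
        rw [smul_mul_assoc, hx, smul_eq_mul, map_mul, Algebra.smul_def]
    exact key n δ' fun w => ⟨ε w, hε w, fun x t h => hF x w t h⟩
  · have h1 : δ' (algebraMap T L t) = ε 1 t := hF _ 1 t (by simp)
    have h2 := hε' 1 t
    rw [one_smul] at h2
    rw [h1, h2]

end DiffOp

section Localize

variable (A T L : Type*) [CommRing A] [CommRing T] [Algebra A T]
  [CommRing L] [Algebra T L] [Algebra A L] [IsScalarTower A T L]

theorem exists_localize (W : Submonoid T) [IsLocalization W L] (δ : diffOps A T T) :
    ∃ δ' : diffOps A T L, ∀ t, δ'.1 (algebraMap T L t) = algebraMap T L (δ.1 t) := by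
  obtain ⟨n, hn⟩ := δ.2
  have : OrderLT T n ((Algebra.linearMap T L).restrictScalars A ∘ₗ δ.1) :=
    OrderLT.post _ (by simp [Algebra.smul_def]) hn
  obtain ⟨δ', h, h'⟩ := OrderLT.exists_extension W this
  exact ⟨⟨δ', n, h⟩, h'⟩

variable {A T L} in
theorem localize_unique (W : Submonoid T) [IsLocalization W L] {δ ε : diffOps A T L}
    (h : ∀ t, δ.1 (algebraMap T L t) = ε.1 (algebraMap T L t)) : δ = ε := by
  obtain ⟨n, hn⟩ := (δ - ε).2
  have h0 : (δ - ε).1 = 0 := by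
    refine OrderLT.eq_zero_of_localization W ?_ hn fun t => ?_
    · intro w hw x hx
      rw [Algebra.smul_def] at hx
      exact (IsLocalization.map_units L ⟨w, hw⟩).mul_right_eq_zero.mp hx
    · simp [h t]
  exact sub_eq_zero.mp (Subtype.ext h0)

/-- The unique extension of `A`-linear differential operators on `T` to differential operators on
the localization `L = W⁻¹T`. -/
noncomputable def localize (W : Submonoid T) [IsLocalization W L] :
    diffOps A T T →+* diffOps A T L where
  toFun δ := (exists_localize A T L W δ).choose
  map_one' := localize_unique W fun t => by
    rw [(exists_localize A T L W 1).choose_spec]; rfl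
  map_zero' := localize_unique W fun t => by
    rw [(exists_localize A T L W 0).choose_spec]; exact map_zero _
  map_mul' δ ε := localize_unique W fun t => by
    rw [(exists_localize A T L W _).choose_spec]
    simp only [Subring.coe_mul, Module.End.mul_apply]
    rw [(exists_localize A T L W ε).choose_spec, (exists_localize A T L W δ).choose_spec]
  map_add' δ ε := localize_unique W fun t => by
    rw [(exists_localize A T L W _).choose_spec]
    simp only [Subring.coe_add, LinearMap.add_apply]
    rw [(exists_localize A T L W ε).choose_spec, (exists_localize A T L W δ).choose_spec, map_add]

@[simp] theorem localize_algebraMap (W : Submonoid T) [IsLocalization W L] (δ : diffOps A T T)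
    (t : T) : (localize A T L W δ).1 (algebraMap T L t) = algebraMap T L (δ.1 t) :=
  (exists_localize A T L W δ).choose_spec t

/-- The extensions of an operator to two localizations are compatible. -/
theorem localize_map {L' : Type*} [CommRing L'] [Algebra T L'] [Algebra A L'] [IsScalarTower A T L']
    (W W' : Submonoid T) [IsLocalization W L] [IsLocalization W' L'] (g : L →ₐ[T] L')
    (δ : diffOps A T T) (x : L) :
    g ((localize A T L W δ).1 x) = (localize A T L' W' δ).1 (g x) := by
  let g' : L →ₗ[A] L' := g.toLinearMap.restrictScalars A
  have hg : ∀ (t : T) (x : L), g' (t • x) = t • g' x := fun t x => map_smul g t x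
  have hg' : ∀ t : T, g' (algebraMap T L t) = algebraMap T L' t := fun t => g.commutes t
  obtain ⟨a, ha⟩ := (localize A T L W δ).2
  obtain ⟨b, hb⟩ := (localize A T L' W' δ).2
  have h0 : g' ∘ₗ (localize A T L W δ).1 - (localize A T L' W' δ).1 ∘ₗ g' = 0 := by
    refine OrderLT.eq_zero_of_localization (T := T) (n := max a b) W ?_
      (((OrderLT.post g' hg ha).mono (le_max_left _ _)).sub
        ((OrderLT.pre g' hg hb).mono (le_max_right _ _))) fun t => ?_
    · intro w hw y hy
      rw [Algebra.smul_def] at hy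
      refine IsUnit.mul_right_eq_zero ?_ |>.mp hy
      rw [← g.commutes w]
      exact (IsLocalization.map_units L ⟨w, hw⟩).map g
    · simp only [LinearMap.sub_apply, LinearMap.comp_apply, hg', localize_algebraMap, sub_self]
  exact sub_eq_zero.mp (LinearMap.congr_fun h0 x)

end Localize

section BaseChange

variable (A R R' : Type*) [CommRing A] [CommRing R] [Algebra A R] [CommRing R'] [Algebra A R']

theorem OrderLT.rTensor {n : ℕ} : ∀ {δ : R →ₗ[A] R}, OrderLT R n δ →
    OrderLT (R ⊗[A] R') n (LinearMap.rTensor R' δ) := by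
  induction n with
  | zero =>
    intro δ h
    obtain rfl : δ = 0 := h
    exact LinearMap.rTensor_zero _
  | succ n ih =>
    intro δ h t
    induction t with
    | zero =>
      have : commutator (0 : R ⊗[A] R') (LinearMap.rTensor R' δ) = 0 := by ext; simp
      rw [this]; exact OrderLT.zero n
    | add s t hs ht =>
      have : commutator (s + t) (LinearMap.rTensor R' δ) =
          commutator s (LinearMap.rTensor R' δ) + commutator t (LinearMap.rTensor R' δ) := by
        ext x y
        simp only [LinearMap.coe_restrictScalars, commutator_apply, LinearMap.add_apply,
          add_smul, map_add, TensorProduct.AlgebraTensorModule.curry_apply,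
          TensorProduct.curry_apply]
        abel
      rw [this]; exact hs.add ht
    | tmul r r' =>
      have : commutator (r ⊗ₜ[A] r') (LinearMap.rTensor R' δ) =
          Algebra.lsmul A A (R ⊗[A] R') ((1 : R) ⊗ₜ[A] r') ∘ₗ
            LinearMap.rTensor R' (commutator r δ) := by
        ext x y
        simp [TensorProduct.sub_tmul, mul_sub]
      rw [this]
      refine OrderLT.post _ ?_ (ih (h r))
      intro s x
      simp only [Algebra.lsmul_coe, smul_eq_mul]; ring

/-- The ring homomorphism `D_{R|A} → D_{(R ⊗ R')|A}`, `δ ↦ δ ⊗ id`. -/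
noncomputable def extendLeft : diffOps A R R →+* diffOps A (R ⊗[A] R') (R ⊗[A] R') :=
  RingHom.codRestrict
    ((Module.End.rTensorAlgHom A R R' : Module.End A R →+* Module.End A (R ⊗[A] R')).comp
      (diffOps A R R).subtype)
    (diffOps A (R ⊗[A] R') (R ⊗[A] R')) fun δ => by
      obtain ⟨n, hn⟩ := δ.2
      exact ⟨n, OrderLT.rTensor A R R' hn⟩

@[simp] theorem extendLeft_tmul (δ : diffOps A R R) (r : R) (r' : R') :
    (extendLeft A R R' δ).1 (r ⊗ₜ[A] r') = δ.1 r ⊗ₜ[A] r' := rfl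

end BaseChange

/-! ## The Čech complex -/

section Cech

variable {T : Type*} [CommRing T] {m : ℕ}

/-- The localization of `T` at the product of the `z i`, `i ∈ s`. -/
def CechTerm (z : Fin m → T) (s : Finset (Fin m)) : Type _ :=
  Localization.Away (∏ i ∈ s, z i)

noncomputable instance (z : Fin m → T) (s : Finset (Fin m)) : CommRing (CechTerm z s) :=
  inferInstanceAs (CommRing (Localization.Away (∏ i ∈ s, z i)))

noncomputable instance (z : Fin m → T) (s : Finset (Fin m)) : Algebra T (CechTerm z s) :=
  inferInstanceAs (Algebra T (Localization.Away (∏ i ∈ s, z i)))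

noncomputable instance {A : Type*} [CommRing A] [Algebra A T] (z : Fin m → T)
    (s : Finset (Fin m)) : Algebra A (CechTerm z s) :=
  inferInstanceAs (Algebra A (Localization.Away (∏ i ∈ s, z i)))

instance {A : Type*} [CommRing A] [Algebra A T] (z : Fin m → T) (s : Finset (Fin m)) :
    IsScalarTower A T (CechTerm z s) :=
  inferInstanceAs (IsScalarTower A T (Localization.Away (∏ i ∈ s, z i)))

instance (z : Fin m → T) (s : Finset (Fin m)) :
    IsLocalization.Away (∏ i ∈ s, z i) (CechTerm z s) :=
  inferInstanceAs (IsLocalization.Away _ (Localization.Away (∏ i ∈ s, z i)))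

/-- The localization map `T_{z_s} → T_{z_t}` for `s ⊆ t`. -/
noncomputable def CechTerm.res (z : Fin m → T) {s t : Finset (Fin m)} (h : s ⊆ t) :
    CechTerm z s →ₐ[T] CechTerm z t :=
  IsLocalization.Away.liftAlgHom (f := Algebra.ofId T (CechTerm z t)) (∏ i ∈ s, z i)
    (isUnit_of_dvd_unit (map_dvd (algebraMap T (CechTerm z t)) (Finset.prod_dvd_prod_of_subset _ _ z h))
      (IsLocalization.Away.algebraMap_isUnit (∏ i ∈ t, z i)))

/-- The map `T_{z_s} → T'_{z'_s}` induced by an `A`-algebra homomorphism `T → T'` that sends each `z i` to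
`z' i`. -/
noncomputable def CechTerm.map {A T' : Type*} [CommRing A] [Algebra A T] [CommRing T']
    [Algebra A T'] (φ : T →ₐ[A] T') (z : Fin m → T)
    (z' : Fin m → T') (h : ∀ i, φ (z i) = z' i) (s : Finset (Fin m)) :
    CechTerm z s →+* CechTerm z' s :=
  IsLocalization.Away.lift (∏ i ∈ s, z i) 
    (g := (algebraMap T' (CechTerm z' s)).comp (φ : T →+* T'))
    (by
      simp only [RingHom.comp_apply, RingHom.coe_coe, map_prod φ, h]
      exact IsLocalization.Away.algebraMap_isUnit (∏ i ∈ s, z' i))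

/-- The module `C^k(z; T) = ∏_{#s = k} T_{z_s}` of Čech cochains of degree `k`. -/
abbrev CechCochain (z : Fin m → T) (k : ℕ) : Type _ :=
  (s : {s : Finset (Fin m) // s.card = k}) → CechTerm z s.1

/-- The map on Čech cochains induced by an algebra homomorphism that sends each `z i` to `z' i`. -/
noncomputable def CechCochain.map {A T' : Type*} [CommRing A] [Algebra A T] [CommRing T']
    [Algebra A T'] (φ : T →ₐ[A] T') (z : Fin m → T) (z' : Fin m → T') (h : ∀ i, φ (z i) = z' i)
    (k : ℕ) (c : CechCochain z k) : CechCochain z' k :=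
  fun s => CechTerm.map φ z z' h s.1 (c s)

/-- The Čech differential
`(dc)_s = ∑_{i ∈ s} (-1)^{#{j ∈ s | j < i}} c_{s ∖ i}`. -/
noncomputable def cechD (z : Fin m → T) (k : ℕ) : CechCochain z k →ₗ[T] CechCochain z (k + 1) :=
  LinearMap.pi fun s => ∑ i : {i // i ∈ s.1}, (-1 : T) ^ (s.1.filter (· < i.1)).card •
    (CechTerm.res z (s.1.erase_subset i.1)).toLinearMap ∘ₗ
      LinearMap.proj (⟨s.1.erase i.1, by rw [Finset.card_erase_of_mem i.2, s.2]; rfl⟩ :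
        {s : Finset (Fin m) // s.card = k})

end Cech

section CechDModule

variable {A R R' : Type*} [CommRing A] [CommRing R] [Algebra A R] [CommRing R'] [Algebra A R']
  {m : ℕ}

/-- The action of `D_{R|A}` on a localization of `R ⊗ R'`: an operator `δ` acts by the unique
differential operator extending `δ ⊗ id`. -/
noncomputable instance (z : Fin m → R ⊗[A] R') (s : Finset (Fin m)) :
    Module (diffOps A R R) (CechTerm z s) :=
  Module.compHom (CechTerm z s)
    ((diffOps A (R ⊗[A] R') (CechTerm z s)).subtype.comp
      ((localize A (R ⊗[A] R') (CechTerm z s) (Submonoid.powers (∏ i ∈ s, z i))).comp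
        (extendLeft A R R')))

theorem smul_cechTerm (z : Fin m → R ⊗[A] R') (s : Finset (Fin m)) (δ : diffOps A R R)
    (x : CechTerm z s) :
    δ • x = (localize A (R ⊗[A] R') (CechTerm z s) (Submonoid.powers (∏ i ∈ s, z i))
      (extendLeft A R R' δ)).1 x := rfl

theorem res_smul (z : Fin m → R ⊗[A] R') {s t : Finset (Fin m)} (h : s ⊆ t) (δ : diffOps A R R)
    (x : CechTerm z s) : CechTerm.res z h (δ • x) = δ • CechTerm.res z h x :=
  localize_map A (R ⊗[A] R') (CechTerm z s) (Submonoid.powers (∏ i ∈ s, z i))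
    (Submonoid.powers (∏ i ∈ t, z i)) (CechTerm.res z h) (extendLeft A R R' δ) x

/-- The Čech differential, as a map of `D_{R|A}`-modules. -/
noncomputable def cechDD (z : Fin m → R ⊗[A] R') (k : ℕ) :
    CechCochain z k →ₗ[diffOps A R R] CechCochain z (k + 1) where
  toFun := cechD z k
  map_add' := map_add _
  map_smul' δ c := by
    ext s
    simp only [cechD, LinearMap.pi_apply, LinearMap.sum_apply, LinearMap.smul_apply,
      LinearMap.comp_apply, LinearMap.proj_apply, Pi.smul_apply, AlgHom.toLinearMap_apply,
      RingHom.id_apply, Finset.smul_sum]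
    refine Finset.sum_congr rfl fun i _ => ?_
    rw [res_smul]
    rcases neg_one_pow_eq_or (R ⊗[A] R') (s.1.filter (· < i.1)).card with h | h <;> simp [h]

/-- The Čech coboundaries of degree `k`. -/
noncomputable def cechCoboundaries (z : Fin m → R ⊗[A] R') :
    (k : ℕ) → Submodule (diffOps A R R) (CechCochain z k)
  | 0 => ⊥
  | k + 1 => LinearMap.range (cechDD z k)

/-- The Čech cocycles of degree `k`. -/
noncomputable def cechCocycles (z : Fin m → R ⊗[A] R') (k : ℕ) :
    Submodule (diffOps A R R) (CechCochain z k) :=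
  LinearMap.ker (cechDD z k)

/-- The local cohomology module `H^k_{(z)}(R ⊗ R')`, computed by the Čech complex on `z`, with its
`D_{R|A}`-module structure. -/
abbrev LocalCohomology (z : Fin m → R ⊗[A] R') (k : ℕ) : Type _ :=
  cechCocycles z k ⧸ (cechCoboundaries z k).submoduleOf (cechCocycles z k)

end CechDModule

/-! ## Hypersurfaces -/

section Hypersurface

open MvPolynomial

variable {A : Type*} [CommRing A] {n : ℕ}

/-- The hypersurface ring `R = A[x_0, …, x_n] / (f)`. -/
def Hypersurface (f : MvPolynomial (Fin (n + 1)) A) : Type _ :=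
  MvPolynomial (Fin (n + 1)) A ⧸ Ideal.span {f}

noncomputable instance (f : MvPolynomial (Fin (n + 1)) A) : CommRing (Hypersurface f) :=
  inferInstanceAs (CommRing (MvPolynomial (Fin (n + 1)) A ⧸ Ideal.span {f}))

noncomputable instance (f : MvPolynomial (Fin (n + 1)) A) : Algebra A (Hypersurface f) :=
  inferInstanceAs (Algebra A (MvPolynomial (Fin (n + 1)) A ⧸ Ideal.span {f}))

/-- The canonical surjection `S = A[x_0, …, x_n] → R`. -/
noncomputable def toHypersurface (f : MvPolynomial (Fin (n + 1)) A) :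
    MvPolynomial (Fin (n + 1)) A →ₐ[A] Hypersurface f :=
  Ideal.Quotient.mkₐ A (Ideal.span {f})

/-- The class of `x_i` in `R`. -/
noncomputable def coord (f : MvPolynomial (Fin (n + 1)) A) (i : Fin (n + 1)) : Hypersurface f :=
  toHypersurface f (X i)

/-- The elements `y_i - x_i = 1 ⊗ x_i - x_i ⊗ 1` of `R ⊗ R`. -/
noncomputable def diagR (f : MvPolynomial (Fin (n + 1)) A) (i : Fin (n + 1)) :
    Hypersurface f ⊗[A] Hypersurface f :=
  1 ⊗ₜ coord f i - coord f i ⊗ₜ 1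

/-- The elements `y_i - x_i = 1 ⊗ x_i - x_i ⊗ 1` of `R ⊗ S = R[y_0, …, y_n]`, where
`S = A[x_0, …, x_n]`. -/
noncomputable def diagS (f : MvPolynomial (Fin (n + 1)) A) (i : Fin (n + 1)) :
    Hypersurface f ⊗[A] MvPolynomial (Fin (n + 1)) A :=
  1 ⊗ₜ X i - coord f i ⊗ₜ 1

/-- The element `f(y) = 1 ⊗ f` of `R ⊗ S = R[y_0, …, y_n]`. -/
noncomputable def fy (f : MvPolynomial (Fin (n + 1)) A) :
    Hypersurface f ⊗[A] MvPolynomial (Fin (n + 1)) A :=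
  1 ⊗ₜ f

/-- The projection `R ⊗ S → R ⊗ R`, with kernel generated by `f(y)`. -/
noncomputable def proj (f : MvPolynomial (Fin (n + 1)) A) :
    Hypersurface f ⊗[A] MvPolynomial (Fin (n + 1)) A →ₐ[A] Hypersurface f ⊗[A] Hypersurface f :=
  Algebra.TensorProduct.map (AlgHom.id A _) (toHypersurface f)

theorem proj_diagS (f : MvPolynomial (Fin (n + 1)) A) (i : Fin (n + 1)) :
    proj f (diagS f i) = diagR f i := by
  simp [proj, diagS, diagR, coord]

/-- The Čech cochain `p / ∏_i (y_i - x_i)^{N+1}` of top degree `n + 1` over `R ⊗ S`. -/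
noncomputable def topCochain (f : MvPolynomial (Fin (n + 1)) A) (N : ℕ)
    (p : Hypersurface f ⊗[A] MvPolynomial (Fin (n + 1)) A) : CechCochain (diagS f) (n + 1) :=
  fun s => IsLocalization.mk' (CechTerm (diagS f) s.1) p
    (⟨(∏ i ∈ s.1, diagS f i) ^ (N + 1), N + 1, rfl⟩ :
      Submonoid.powers (∏ i ∈ s.1, diagS f i))

/-- `ConnectsTo f c N p`: the connecting homomorphism
`δ_{f(y)} : H^n_Δ(R ⊗ R) → H^{n+1}_Δ(R ⊗ S)` of
`0 → R ⊗ S --f(y)--> R ⊗ S → R ⊗ R → 0`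
sends the class of the cocycle `c` to the class of `p / ∏_i (y_i - x_i)^{N+1}`, as computed by a
lift `c'` of `c` with `d c' = f(y) · p / ∏_i (y_i - x_i)^{N+1}`. -/
def ConnectsTo (f : MvPolynomial (Fin (n + 1)) A) (c : CechCochain (diagR f) n) (N : ℕ)
    (p : Hypersurface f ⊗[A] MvPolynomial (Fin (n + 1)) A) : Prop :=
  ∃ c' : CechCochain (diagS f) n,
    CechCochain.map (proj f) (diagS f) (diagR f) (proj_diagS f) n c' = c ∧
      cechD (diagS f) n c' = fy f • topCochain f N p

/-- The `R`-algebra map `R ⊗ S → R[t_0, …, t_n]` that writes an element as a polynomial in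
`t_i = y_i - x_i` with coefficients in `R`. -/
noncomputable def taylor (f : MvPolynomial (Fin (n + 1)) A) :
    Hypersurface f ⊗[A] MvPolynomial (Fin (n + 1)) A →ₐ[Hypersurface f]
      MvPolynomial (Fin (n + 1)) (Hypersurface f) :=
  Algebra.TensorProduct.lift (Algebra.ofId _ _)
    (aeval fun i => X i + C (coord f i)) fun _ _ => Commute.all _ _

theorem taylor_diagS (f : MvPolynomial (Fin (n + 1)) A) (i : Fin (n + 1)) :
    taylor f (diagS f i) = X i := by
  simp only [taylor, diagS, map_sub, Algebra.TensorProduct.lift_tmul, map_one, aeval_X, one_mul,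
    mul_one, Algebra.ofId_apply, algebraMap_eq]
  exact add_sub_cancel_right (X i) (C (coord f i))

/-- The functional `((y_0 - x_0)^N ⋯ (y_n - x_n)^N)^⋆`: the coefficient of
`(y_0 - x_0)^N ⋯ (y_n - x_n)^N` in `q ∈ R ⊗ S`. -/
noncomputable def topCoeff (f : MvPolynomial (Fin (n + 1)) A) (N : ℕ)
    (q : Hypersurface f ⊗[A] MvPolynomial (Fin (n + 1)) A) : Hypersurface f :=
  coeff (Finsupp.equivFunOnFinite.symm fun _ => N) (taylor f q)

/-- The value at `g ∈ S` of the differential operator `S → R` that `ϱ^* ∘ γ_N` attaches to the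
class of `p` in the top Koszul cohomology `(R ⊗ S) / ((y_i - x_i)^{N+1})_i`. Here `γ_N` is the
`R ⊗ S`-linear map with `γ_N(1) = ((y_0 - x_0)^N ⋯ (y_n - x_n)^N)^⋆`, so that
`γ_N(p)(q) = γ_N(1)(p q)`, and `ϱ(g) = 1 ⊗ g`. -/
noncomputable def koszulOp (f : MvPolynomial (Fin (n + 1)) A) (N : ℕ)
    (p : Hypersurface f ⊗[A] MvPolynomial (Fin (n + 1)) A) (g : MvPolynomial (Fin (n + 1)) A) :
    Hypersurface f :=
  topCoeff f N (p * 1 ⊗ₜ g)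

end Hypersurface

end HypersurfaceDiff

/-!
Write `Q = R ⊗ S`, `P = R ⊗ R` and `t_i = y_i - x_i`, so that `Q = R[t_0, …, t_n]`
(`taylorEquiv`) and `P = Q / f(y)`.

The Čech complex of `Q` on the `t_i` has no cohomology in degree `n`: its cocycles are linear
relations between powers of the `t_i`, which form a regular sequence
(`mem_cechCoboundaries_of_cechD_eq_zero`). Hence the connecting homomorphism identifies `H^n(P)` with
the kernel of `f(y)` on `H^{n+1}(Q)`.

The top cohomology `H^{n+1}(Q)` is dual to `S`: to a class `x` corresponds the operator
`g ↦ Res(g(y) x)` from `S` to `R`, where `residue` takes the coefficient of `∏_i t_i^{-1}`. The residue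
vanishes on coboundaries (`residue_cechD`), and a class all of whose `S`-multiples have residue zero
is zero (`exists_eq_cechD_of_residue_eq_zero`). These operators are differential operators, because
commutators with elements of `S` multiply `x` by elements of the ideal `(t_0, …, t_n)`, some power
of which kills `x` (`orderLT_of_eq_koszulOp`). The classes killed by `f(y)` give the operators that
vanish on `f S`, that is, operators on `R`.

It remains to see that every differential operator on `R` arises, and that the correspondence is
`D_{R|A}`-linear. As `f(y) - f(x)` lies in `(t_0, …, t_n)`, the class of `1 / ∏_i t_i` is killed by
`f(y)`; so it comes from a class `η` in `H^n(P)`, whose operator is the identity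
(`exists_connectsTo_one`). The map `δ ↦ δ • η` is `D_{R|A}`-linear by definition. Since
`f(y) = 1 ⊗ f` commutes with `δ ⊗ id`, so does the connecting homomorphism, and the operator of `δ • η`
is `g ↦ Res(g(y) δ(1 / ∏_i t_i))`. By a form of Cauchy's integral formula this equals `δ(g)`
(`residue_smul_topCochain`, deduced from `residue_invMonomial_mul_smul`). So `δ ↦ δ • η` is a
bijection, and its inverse is the map `e`.
-/

namespace HypersurfaceDiff

/-! ### Čech cochains as families of fractions -/

section CechFractions

variable {T : Type*} [CommRing T] {m : ℕ}

/-- The fraction `p / (∏_{i ∈ s} z_i)^M`. -/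
noncomputable def CechTerm.frac (z : Fin m → T) (s : Finset (Fin m)) (M : ℕ) (p : T) :
    CechTerm z s :=
  IsLocalization.mk' (CechTerm z s) p
    (⟨(∏ i ∈ s, z i) ^ M, M, rfl⟩ : Submonoid.powers (∏ i ∈ s, z i))

namespace CechTerm

variable (z : Fin m → T) (s : Finset (Fin m))

variable {z s} in
theorem eq_frac_iff {M : ℕ} {p : T} {x : CechTerm z s} :
    x = frac z s M p ↔
      x * algebraMap T (CechTerm z s) ((∏ i ∈ s, z i) ^ M) = algebraMap T (CechTerm z s) p :=
  IsLocalization.eq_mk'_iff_mul_eq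

theorem frac_mul_algebraMap (M : ℕ) (p : T) :
    frac z s M p * algebraMap T (CechTerm z s) ((∏ i ∈ s, z i) ^ M) =
      algebraMap T (CechTerm z s) p :=
  eq_frac_iff.mp rfl

variable {z s} in
theorem exists_eq_frac (x : CechTerm z s) : ∃ M p, x = frac z s M p := by
  obtain ⟨⟨p, ⟨_, M, rfl⟩⟩, h⟩ := IsLocalization.surj (Submonoid.powers (∏ i ∈ s, z i)) x
  exact ⟨M, p, eq_frac_iff.mpr h⟩

theorem frac_add_exp (M K : ℕ) (p : T) :
    frac z s (M + K) (p * (∏ i ∈ s, z i) ^ K) = frac z s M p := by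
  rw [eq_comm, eq_frac_iff, pow_add, map_mul, ← mul_assoc, frac_mul_algebraMap, map_mul]

theorem smul_frac (M : ℕ) (q p : T) : q • frac z s M p = frac z s M (q * p) := by
  rw [eq_frac_iff, smul_mul_assoc, frac_mul_algebraMap, map_mul, Algebra.smul_def]

theorem frac_add (M : ℕ) (p q : T) : frac z s M (p + q) = frac z s M p + frac z s M q := by
  rw [eq_comm, eq_frac_iff, add_mul, frac_mul_algebraMap, frac_mul_algebraMap, map_add]

theorem frac_zero (M : ℕ) : frac z s M 0 = 0 := by
  rw [eq_comm, eq_frac_iff, zero_mul, map_zero]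

theorem frac_sub (M : ℕ) (p q : T) : frac z s M (p - q) = frac z s M p - frac z s M q := by
  rw [eq_comm, eq_frac_iff, sub_mul, frac_mul_algebraMap, frac_mul_algebraMap, map_sub]

theorem frac_sum {ι : Type*} (I : Finset ι) (M : ℕ) (p : ι → T) :
    frac z s M (∑ i ∈ I, p i) = ∑ i ∈ I, frac z s M (p i) := by
  rw [eq_comm, eq_frac_iff, Finset.sum_mul, map_sum]
  exact Finset.sum_congr rfl fun i _ => frac_mul_algebraMap z s M (p i)

variable {z s} in
theorem exists_of_frac_eq_zero {M : ℕ} {p : T} (h : frac z s M p = 0) :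
    ∃ K, (∏ i ∈ s, z i) ^ K * p = 0 := by
  obtain ⟨⟨_, K, rfl⟩, hK⟩ := (IsLocalization.mk'_eq_zero_iff _ _).mp h
  exact ⟨K, hK⟩

theorem frac_inj (hz : ∀ i, z i ∈ nonZeroDivisors T) {M : ℕ} {p q : T}
    (h : frac z s M p = frac z s M q) : p = q := by
  rw [← sub_eq_zero, ← frac_sub] at h
  obtain ⟨K, hK⟩ := exists_of_frac_eq_zero h
  rw [mul_comm] at hK
  exact sub_eq_zero.mp ((mul_right_mem_nonZeroDivisors_eq_zero_iff
    (pow_mem (prod_mem fun i _ => hz i) K)).mp hK)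

variable {s} in
theorem res_frac {i : Fin m} (hi : i ∈ s) (M : ℕ) (p : T) :
    res z (s.erase_subset i) (frac z (s.erase i) M p) = frac z s M (p * z i ^ M) := by
  have h := congrArg (res z (s.erase_subset i)) (frac_mul_algebraMap z (s.erase i) M p)
  rw [map_mul, AlgHom.commutes, AlgHom.commutes] at h
  rw [eq_frac_iff, ← Finset.mul_prod_erase s z hi, mul_pow, mul_comm (z i ^ M), map_mul,
    ← mul_assoc, h, map_mul]

/-- A nonzerodivisor of `T` acts injectively on the localizations of `T`. -/
theorem smul_eq_zero_iff_of_mem_nonZeroDivisors {a : T} (ha : a ∈ nonZeroDivisors T)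
    {x : CechTerm z s} : a • x = 0 ↔ x = 0 := by
  refine ⟨fun h => ?_, fun h => by rw [h, smul_zero]⟩
  obtain ⟨M, p, rfl⟩ := exists_eq_frac x
  rw [smul_frac] at h
  obtain ⟨K, hK⟩ := exists_of_frac_eq_zero h
  rw [mul_left_comm, mul_comm] at hK
  have h0 := (mul_right_mem_nonZeroDivisors_eq_zero_iff ha).mp hK
  rw [← frac_add_exp z s M K, mul_comm, h0, frac_zero]

theorem map_frac {A T' : Type*} [CommRing A] [Algebra A T] [CommRing T'] [Algebra A T']
    (φ : T →ₐ[A] T') (z' : Fin m → T') (h : ∀ i, φ (z i) = z' i) (M : ℕ) (p : T) :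
    map φ z z' h s (frac z s M p) = frac z' s M (φ p) := by
  have hc : ∀ q : T, map φ z z' h s (algebraMap T _ q) = algebraMap T' _ (φ q) :=
    fun q => IsLocalization.Away.lift_eq _ _ q
  have e := congrArg (map φ z z' h s) (frac_mul_algebraMap z s M p)
  rw [map_mul, hc, hc] at e
  rw [eq_frac_iff, ← e]
  simp only [map_pow, map_prod, h]

end CechTerm

namespace CechCochain

open CechTerm

variable (z : Fin m → T)

/-- The cochain of degree `k` with components `β(s) / (∏_{i ∈ s} z_i)^M`. Letting `β` be defined
on all subsets `s`, and not only on those with `k` elements, keeps the types of the components out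
of the computations. -/
noncomputable def ofFrac (M k : ℕ) (β : Finset (Fin m) → T) : CechCochain z k :=
  fun s => frac z s.1 M (β s.1)

variable {z}

theorem exists_eq_ofFrac {k : ℕ} (c : CechCochain z k) (L : ℕ) :
    ∃ M β, L ≤ M ∧ c = ofFrac z M k β := by
  choose M p h using fun s => exists_eq_frac (c s)
  let M₀ := L + ∑ s, M s
  have hM : ∀ s, M s ≤ M₀ := fun s =>
    (Finset.single_le_sum (fun _ _ => Nat.zero_le _) (Finset.mem_univ s)).trans
      (Nat.le_add_left _ _)
  refine ⟨M₀, fun s => if hs : s.card = k then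
    p ⟨s, hs⟩ * (∏ i ∈ s, z i) ^ (M₀ - M ⟨s, hs⟩) else 0, Nat.le_add_right _ _, ?_⟩
  funext s
  obtain ⟨s, hs⟩ := s
  rw [h ⟨s, hs⟩]
  simp only [ofFrac, dif_pos hs]
  rw [← frac_add_exp z s (M ⟨s, hs⟩) (M₀ - M ⟨s, hs⟩), Nat.add_sub_cancel' (hM _)]

theorem smul_ofFrac (M k : ℕ) (q : T) (β : Finset (Fin m) → T) :
    q • ofFrac z M k β = ofFrac z M k fun s => q * β s :=
  funext fun s => smul_frac z s.1 M q (β s.1)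

protected theorem smul_sub (k : ℕ) (q : T) (c d : CechCochain z k) :
    q • (c - d) = q • c - q • d :=
  _root_.smul_sub q c d

protected theorem mul_smul (k : ℕ) (q r : T) (c : CechCochain z k) : (q * r) • c = q • r • c :=
  SemigroupAction.mul_smul q r c

theorem smul_one_eq_algebraMap (k : ℕ) (q : T) :
    q • (1 : CechCochain z k) = algebraMap T (CechCochain z k) q :=
  (Algebra.algebraMap_eq_smul_one q).symm

theorem map_ofFrac {A T' : Type*} [CommRing A] [Algebra A T] [CommRing T'] [Algebra A T']
    (φ : T →ₐ[A] T') (z' : Fin m → T') (h : ∀ i, φ (z i) = z' i) (M k : ℕ)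
    (β : Finset (Fin m) → T) :
    map φ z z' h k (ofFrac z M k β) = ofFrac z' M k fun s => φ (β s) :=
  funext fun s => map_frac z s.1 φ z' h M (β s.1)

theorem cechD_ofFrac (M k : ℕ) (β : Finset (Fin m) → T) :
    cechD z k (ofFrac z M k β) = ofFrac z M (k + 1) fun s =>
      ∑ i ∈ s, (-1) ^ (s.filter (· < i)).card * (β (s.erase i) * z i ^ M) := by
  funext s
  simp only [cechD, LinearMap.pi_apply, LinearMap.sum_apply, LinearMap.smul_apply,
    LinearMap.comp_apply, LinearMap.proj_apply, AlgHom.toLinearMap_apply, ofFrac]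
  rw [frac_sum, ← Finset.sum_coe_sort s.1]
  refine Finset.sum_congr rfl fun i _ => ?_
  rw [res_frac z i.2, smul_frac]

theorem sign_mul_sign_erase {s : Finset (Fin m)} {i j : Fin m} (hi : i ∈ s)
    (hij : i < j) :
    (-1 : T) ^ (s.filter (· < i)).card * (-1) ^ ((s.erase i).filter (· < j)).card =
      -((-1) ^ (s.filter (· < j)).card * (-1) ^ ((s.erase j).filter (· < i)).card) := by
  have h1 : (s.erase j).filter (· < i) = s.filter (· < i) := by
    rw [Finset.filter_erase, Finset.erase_eq_of_notMem]
    simp [hij.le]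
  have h2 : (s.filter (· < j)).card = ((s.erase i).filter (· < j)).card + 1 := by
    rw [Finset.filter_erase, Finset.card_erase_add_one (by simp [hi, hij])]
  rw [h1, h2, pow_succ]
  ring

theorem sign_mul_self (k : ℕ) : (-1 : T) ^ k * (-1) ^ k = 1 := by
  rw [← pow_add, Even.neg_one_pow ⟨k, rfl⟩]

theorem cechD_cechD (k : ℕ) (c : CechCochain z k) : cechD z (k + 1) (cechD z k c) = 0 := by
  obtain ⟨M, β, -, rfl⟩ := exists_eq_ofFrac c 0
  rw [cechD_ofFrac, cechD_ofFrac]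
  funext s
  obtain ⟨s, hs⟩ := s
  simp only [ofFrac, Pi.zero_apply]
  convert frac_zero z s M
  simp only [Finset.sum_mul, Finset.mul_sum]
  rw [Finset.sum_sigma']
  have key : ∀ i ∈ s, ∀ j, i < j →
      (-1 : T) ^ (s.filter (· < i)).card * ((-1) ^ ((s.erase i).filter (· < j)).card *
        (β ((s.erase i).erase j) * z j ^ M) * z i ^ M) +
      (-1 : T) ^ (s.filter (· < j)).card * ((-1) ^ ((s.erase j).filter (· < i)).card *
        (β ((s.erase j).erase i) * z i ^ M) * z j ^ M) = 0 := by
    intro i hi j hij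
    have := sign_mul_sign_erase (T := T) hi hij
    rw [Finset.erase_right_comm (a := j)]
    linear_combination (β ((s.erase i).erase j) * z j ^ M * z i ^ M) * this
  refine Finset.sum_involution (fun x _ => ⟨x.2, x.1⟩) ?_ ?_ ?_ ?_
  · rintro ⟨i, j⟩ hx
    simp only [Finset.mem_sigma, Finset.mem_erase] at hx
    rcases lt_or_gt_of_ne hx.2.1 with h | h
    · rw [add_comm]
      exact key j hx.2.2 i h
    · exact key i hx.1 j h
  · rintro ⟨i, j⟩ hx _ h
    simp only [Finset.mem_sigma, Finset.mem_erase] at hx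
    simp only [Sigma.mk.injEq] at h
    exact hx.2.1 h.1
  · rintro ⟨i, j⟩ hx
    simp only [Finset.mem_sigma, Finset.mem_erase] at hx ⊢
    exact ⟨hx.2.2, fun h => hx.2.1 h.symm, hx.1⟩
  · rintro ⟨i, j⟩ _
    rfl

section Map

variable {A T' : Type*} [CommRing A] [Algebra A T] [CommRing T'] [Algebra A T']
  {φ : T →ₐ[A] T'} {z' : Fin m → T'} (h : ∀ i, φ (z i) = z' i)

theorem map_surjective (hφ : Function.Surjective φ) (k : ℕ) :
    Function.Surjective (map φ z z' h k) := by
  intro c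
  obtain ⟨M, β, -, rfl⟩ := exists_eq_ofFrac c 0
  choose γ hγ using fun s => hφ (β s)
  exact ⟨ofFrac z M k γ, by simp only [map_ofFrac, hγ]⟩

protected theorem map_sub (k : ℕ) (c d : CechCochain z k) :
    map φ z z' h k (c - d) = map φ z z' h k c - map φ z z' h k d :=
  funext fun s => _root_.map_sub (CechTerm.map φ z z' h s.1) (c s) (d s)

theorem map_cechD (k : ℕ) (c : CechCochain z k) :
    map φ z z' h (k + 1) (cechD z k c) = cechD z' k (map φ z z' h k c) := by
  obtain ⟨M, β, -, rfl⟩ := exists_eq_ofFrac c 0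
  simp only [cechD_ofFrac, map_ofFrac, map_sum, map_mul, map_pow, map_neg, map_one, h]

/-- Localization is exact: if the kernel of `T → T'` is generated by `a`, the kernel of the map on
Čech cochains consists of the multiples of `a`. -/
theorem exists_smul_of_map_eq_zero {a : T} (ha : ∀ p, φ p = 0 → ∃ q, p = a * q) {k : ℕ}
    {c : CechCochain z k} (hc : map φ z z' h k c = 0) : ∃ v : CechCochain z k, c = a • v := by
  obtain ⟨M, β, -, rfl⟩ := exists_eq_ofFrac c 0
  rw [map_ofFrac] at hc
  have key : ∀ s : {s : Finset (Fin m) // s.card = k}, ∃ v : CechTerm z s.1,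
      frac z s.1 M (β s.1) = a • v := by
    intro s
    obtain ⟨K, hK⟩ := exists_of_frac_eq_zero (congrFun hc s)
    obtain ⟨q, hq⟩ := ha ((∏ i ∈ s.1, z i) ^ K * β s.1)
      (by simpa only [map_mul, map_pow, map_prod, h] using hK)
    exact ⟨frac z s.1 (M + K) q, by rw [smul_frac, ← hq, mul_comm, frac_add_exp]⟩
  choose v hv using key
  exact ⟨v, funext hv⟩

theorem map_smul_of_eq_zero {a : T} (ha : φ a = 0) (k : ℕ) (c : CechCochain z k) :
    map φ z z' h k (a • c) = 0 := by
  obtain ⟨M, β, -, rfl⟩ := exists_eq_ofFrac c 0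
  rw [smul_ofFrac, map_ofFrac]
  funext s
  simp only [ofFrac, map_mul, ha, zero_mul, frac_zero, Pi.zero_apply]

end Map

/-! ### Exactness of the Čech complex next to the top degree -/

section Vanishing

theorem eq_univ_of_card_eq_succ {n : ℕ} {s : Finset (Fin (n + 1))} (hs : s.card = n + 1) :
    s = Finset.univ :=
  (Finset.card_eq_iff_eq_univ _).mp (by rw [hs, Fintype.card_fin])

theorem exists_eq_erase_of_card {n : ℕ} {s : Finset (Fin (n + 1))} (hs : s.card = n) :
    ∃ i, s = Finset.univ.erase i := by
  obtain ⟨i, hi⟩ := Finset.card_eq_one.mp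
    (show sᶜ.card = 1 by rw [Finset.card_compl, Fintype.card_fin, hs, Nat.add_sub_cancel_left])
  exact ⟨i, by rw [← compl_compl s, hi, Finset.compl_singleton]⟩

/-- The numerators of a cocycle of degree `n` on `n + 1` nonzerodivisors, with signs, are the
coefficients of a linear relation between powers of these elements. -/
theorem sum_mul_pow_eq_zero_of_cechD_eq_zero {n : ℕ} {z : Fin (n + 1) → T}
    (hz : ∀ i, z i ∈ nonZeroDivisors T) {M : ℕ} {β : Finset (Fin (n + 1)) → T}
    (hc : cechD z n (ofFrac z M n β) = 0) :
    ∑ i, (-1) ^ ((Finset.univ : Finset (Fin (n + 1))).filter (· < i)).card *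
      β (Finset.univ.erase i) * z i ^ M = 0 := by
  rw [cechD_ofFrac] at hc
  have h0 := congrFun hc ⟨Finset.univ, Finset.card_fin _⟩
  rw [Pi.zero_apply, ← frac_zero z Finset.univ M] at h0
  have h1 := frac_inj _ _ hz h0
  simpa only [← mul_assoc] using h1

/-- If all linear relations between powers of the `z i` are consequences of
`z j ^ M * z i ^ M - z i ^ M * z j ^ M = 0`, cocycles of degree `n = k + 1` are coboundaries. -/
theorem exists_cechD_eq_ofFrac {k : ℕ} {z : Fin (k + 2) → T} {M : ℕ}
    {β : Finset (Fin (k + 2)) → T} {q : Fin (k + 2) → Fin (k + 2) → T} (hq0 : ∀ i, q i i = 0)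
    (hq1 : ∀ i j, q i j = -q j i)
    (hq : ∀ i, (-1) ^ ((Finset.univ : Finset (Fin (k + 2))).filter (· < i)).card *
      β (Finset.univ.erase i) = ∑ j, q i j * z j ^ M) :
    ∃ b, cechD z k b = ofFrac z M (k + 1) β := by
  have hβ : ∀ i, β (Finset.univ.erase i) =
      (-1) ^ ((Finset.univ : Finset (Fin (k + 2))).filter (· < i)).card *
        ∑ j, q i j * z j ^ M := by
    intro i
    rw [← hq i, ← mul_assoc, sign_mul_self, one_mul]
  -- The numerator of the component of `b` at the complement of `{i, j}`; it is symmetric because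
  -- both `q` and the product of the two signs are antisymmetric.
  let G : Fin (k + 2) → Fin (k + 2) → T := fun i j =>
    (-1) ^ ((Finset.univ : Finset (Fin (k + 2))).filter (· < i)).card *
      (-1) ^ (((Finset.univ : Finset (Fin (k + 2))).erase i).filter (· < j)).card * q i j
  have hG : ∀ i j, i < j → G i j = G j i := by
    intro i j hij
    simp only [G]
    rw [sign_mul_sign_erase (Finset.mem_univ i) hij, hq1 i j, neg_mul_neg]
  let γ : Finset (Fin (k + 2)) → T :=
    fun s => ∑ x ∈ (sᶜ ×ˢ sᶜ).filter fun x => x.1 < x.2, G x.1 x.2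
  have hγlt : ∀ i j, i < j → ∀ s : Finset (Fin (k + 2)), sᶜ = {i, j} → γ s = G i j := by
    intro i j hij s hs
    simp only [γ, hs]
    rw [show (({i, j} : Finset (Fin (k + 2))) ×ˢ {i, j}).filter (fun x => x.1 < x.2) =
      {(i, j)} by
        ext ⟨a, b⟩
        simp only [Finset.mem_filter, Finset.mem_product, Finset.mem_insert,
          Finset.mem_singleton, Prod.mk.injEq]
        constructor
        · rintro ⟨⟨rfl | rfl, rfl | rfl⟩, h⟩
          · exact absurd h (lt_irrefl _)
          · exact ⟨rfl, rfl⟩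
          · exact absurd (h.trans hij) (lt_irrefl _)
          · exact absurd h (lt_irrefl _)
        · rintro ⟨rfl, rfl⟩
          exact ⟨⟨Or.inl rfl, Or.inr rfl⟩, hij⟩, Finset.sum_singleton]
  have hγ : ∀ i j, j ≠ i → γ ((Finset.univ.erase i).erase j) = G i j := by
    intro i j hij
    have hc : ((Finset.univ.erase i).erase j)ᶜ = {j, i} := by
      rw [Finset.compl_erase, Finset.compl_erase, Finset.compl_univ, insert_empty_eq]
    rcases lt_or_gt_of_ne hij with h | h
    · rw [← hG j i h, hγlt j i h _ hc]
    · rw [hγlt i j h _ (hc.trans (Finset.pair_comm _ _))]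
  refine ⟨ofFrac z M k γ, ?_⟩
  rw [cechD_ofFrac]
  funext s
  obtain ⟨s, hs⟩ := s
  obtain ⟨i, rfl⟩ := exists_eq_erase_of_card hs
  simp only [ofFrac]
  rw [hβ, ← Finset.add_sum_erase _ _ (Finset.mem_univ i), hq0, zero_mul, zero_add,
    Finset.mul_sum]
  congr 1
  refine Finset.sum_congr rfl fun j hj => ?_
  rw [hγ i j (Finset.ne_of_mem_erase hj)]
  simp only [G]
  linear_combination (-1) ^ ((Finset.univ : Finset (Fin (k + 2))).filter (· < i)).card *
    q i j * z j ^ M *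
    sign_mul_self (T := T) (((Finset.univ : Finset (Fin (k + 2))).erase i).filter (· < j)).card

/-- A fraction whose numerator lies in the ideal of the `z i ^ M` is a coboundary of top degree. -/
theorem ofFrac_sum_eq_cechD {n : ℕ} (z : Fin (n + 1) → T) (M : ℕ) (q : Fin (n + 1) → T) :
    ∃ v, ofFrac z M (n + 1) (fun s => ∑ i ∈ s, q i * z i ^ M) = cechD z n v := by
  refine ⟨ofFrac z M n fun s =>
    ∑ i ∈ sᶜ, (-1) ^ ((Finset.univ : Finset (Fin (n + 1))).filter (· < i)).card * q i, ?_⟩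
  rw [cechD_ofFrac]
  funext s
  obtain ⟨s, hs⟩ := s
  obtain rfl := eq_univ_of_card_eq_succ hs
  simp only [ofFrac]
  congr 1
  refine Finset.sum_congr rfl fun i _ => ?_
  rw [Finset.compl_erase, Finset.compl_univ, insert_empty_eq, Finset.sum_singleton, mul_assoc,
    ← mul_assoc, ← mul_assoc, sign_mul_self, one_mul]

end Vanishing

end CechCochain

end CechFractions

/-! ### Relations between powers of the variables -/

section Koszul

/-- Exactness of the Koszul complex in degree one: if each `u i` is a nonzerodivisor modulo the
preceding ones, every linear relation between the `u i` is a consequence of the relations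
`u j * u i - u i * u j = 0`. -/
theorem exists_antisymm_of_sum_mul_eq_zero {T : Type*} [CommRing T] :
    ∀ (k : ℕ) (u p : Fin k → T),
      (∀ i r, r * u i ∈ Ideal.span (u '' {j | j < i}) → r ∈ Ideal.span (u '' {j | j < i})) →
      ∑ i, p i * u i = 0 →
      ∃ q : Fin k → Fin k → T, (∀ i, q i i = 0) ∧ (∀ i j, q i j = -q j i) ∧
        ∀ i, p i = ∑ j, q i j * u j := by
  intro k
  induction k with
  | zero => exact fun u p _ _ => ⟨0, fun i => i.elim0, fun i => i.elim0, fun i => i.elim0⟩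
  | succ k ih =>
    intro u p hreg hp
    have himage : ∀ i : Fin k, u '' {j | j < i.castSucc} = (u ∘ Fin.castSucc) '' {j | j < i} := by
      intro i
      rw [Set.image_comp]
      congr 1
      ext j
      simp only [Set.mem_ofPred_eq, Set.mem_image]
      refine ⟨fun hj => ?_, ?_⟩
      · refine ⟨⟨j, (Fin.lt_def.mp hj).trans i.2⟩, hj, rfl⟩
      · rintro ⟨l, hl, rfl⟩
        exact hl
    have hlast : u '' {j | j < Fin.last k} = Set.range (u ∘ Fin.castSucc) := by
      rw [Set.range_comp, Fin.range_castSucc]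
      rfl
    rw [Fin.sum_univ_castSucc] at hp
    have hmem : p (Fin.last k) ∈ Ideal.span (u '' {j | j < Fin.last k}) := by
      refine hreg _ _ ?_
      rw [hlast, eq_neg_of_add_eq_zero_right hp]
      exact neg_mem (sum_mem fun i _ => Ideal.mul_mem_left _ _ (Ideal.subset_span ⟨i, rfl⟩))
    rw [hlast] at hmem
    obtain ⟨s, hs⟩ := Ideal.mem_span_range_iff_exists_fun.mp hmem
    simp only [Function.comp_apply] at hs
    obtain ⟨q, hq0, hq1, hq⟩ := ih (u ∘ Fin.castSucc)
      (fun i => p i.castSucc + s i * u (Fin.last k))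
      (fun i r h => by rw [← himage] at h ⊢; exact hreg _ _ h)
      (by
        rw [← hp, ← hs, Finset.sum_mul, ← Finset.sum_add_distrib]
        refine Finset.sum_congr rfl fun i _ => ?_
        simp only [Function.comp_apply]
        ring)
    refine ⟨Fin.snoc (α := fun _ => Fin (k + 1) → T)
      (fun i => Fin.snoc (α := fun _ => T) (q i) (-s i)) (Fin.snoc (α := fun _ => T) s 0),
      fun i => ?_, fun i j => ?_, fun i => ?_⟩
    · induction i using Fin.lastCases <;> simp [hq0]
    · induction i using Fin.lastCases <;> induction j using Fin.lastCases <;>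
        simp only [Fin.snoc_last, Fin.snoc_castSucc, neg_zero, neg_neg]
      exact hq1 _ _
    · induction i using Fin.lastCases with
      | last => simp [Fin.sum_univ_castSucc, hs]
      | cast i =>
        simp only [Fin.sum_univ_castSucc, Fin.snoc_last, Fin.snoc_castSucc]
        have := hq i
        simp only [Function.comp_apply] at this
        rw [← this]
        ring

end Koszul

section PolynomialPowers

open MvPolynomial

variable {σ R : Type*} [CommRing R]

theorem mem_span_X_pow_image_iff (M : ℕ) (J : Set σ) (p : MvPolynomial σ R) :
    p ∈ Ideal.span ((fun j => (X j : MvPolynomial σ R) ^ M) '' J) ↔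
      ∀ a ∈ p.support, ∃ j ∈ J, M ≤ a j := by
  have : (fun j => (X j : MvPolynomial σ R) ^ M) '' J =
      (fun a => monomial a (1 : R)) '' ((fun j => Finsupp.single j M) '' J) := by
    rw [← Set.image_comp]
    simp only [Function.comp_def, X_pow_eq_monomial]
  rw [this, mem_ideal_span_monomial_image]
  simp only [Set.exists_mem_image, Finsupp.single_le_iff]

/-- `X i ^ M` is a nonzerodivisor modulo the `M`-th powers of other variables. -/
theorem X_pow_regular (M : ℕ) {J : Set σ} {i : σ} (hi : i ∉ J) {p : MvPolynomial σ R}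
    (h : p * X i ^ M ∈ Ideal.span ((fun j => (X j : MvPolynomial σ R) ^ M) '' J)) :
    p ∈ Ideal.span ((fun j => (X j : MvPolynomial σ R) ^ M) '' J) := by
  rw [mem_span_X_pow_image_iff] at h ⊢
  intro a ha
  obtain ⟨j, hj, hle⟩ := h (a + Finsupp.single i M) (by
    rw [mem_support_iff] at ha ⊢
    rwa [X_pow_eq_monomial, coeff_mul_monomial, mul_one])
  refine ⟨j, hj, ?_⟩
  have hne : i ≠ j := fun h => hi (h ▸ hj)
  simpa [Finsupp.single_eq_of_ne' hne] using hle

end PolynomialPowers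

/-! ### The coordinates `y_i - x_i` on `R ⊗ S` -/

section Taylor

open MvPolynomial

variable {A : Type*} [CommRing A] {n : ℕ} (f : MvPolynomial (Fin (n + 1)) A)

/-- `R ⊗ S` is the polynomial ring over `R` in the variables `y_i - x_i`. -/
noncomputable def taylorEquiv :
    Hypersurface f ⊗[A] MvPolynomial (Fin (n + 1)) A ≃ₐ[Hypersurface f]
      MvPolynomial (Fin (n + 1)) (Hypersurface f) :=
  AlgEquiv.ofAlgHom (taylor f) (aeval (diagS f))
    (by
      refine MvPolynomial.algHom_ext fun i => ?_
      simp [taylor_diagS])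
    (by
      refine Algebra.TensorProduct.ext (by ext) (MvPolynomial.algHom_ext fun i => ?_)
      simp [taylor, diagS, Algebra.TensorProduct.algebraMap_apply])

theorem taylorEquiv_apply (p : Hypersurface f ⊗[A] MvPolynomial (Fin (n + 1)) A) :
    taylorEquiv f p = taylor f p := rfl

theorem taylor_injective : Function.Injective (taylor f) := (taylorEquiv f).injective

theorem taylorEquiv_symm_X (i : Fin (n + 1)) : (taylorEquiv f).symm (X i) = diagS f i := by
  rw [AlgEquiv.symm_apply_eq, taylorEquiv_apply, taylor_diagS]

theorem diagS_mem_nonZeroDivisors (i : Fin (n + 1)) :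
    diagS f i ∈ nonZeroDivisors (Hypersurface f ⊗[A] MvPolynomial (Fin (n + 1)) A) := by
  rw [mem_nonZeroDivisors_iff_right]
  intro p hp
  have h := congrArg (taylor f) hp
  rw [map_mul, taylor_diagS, map_zero] at h
  refine taylor_injective f ?_
  rw [map_zero]
  ext a
  have := congrArg (coeff (a + Finsupp.single i 1)) h
  rwa [coeff_mul_X] at this

/-- Relations between powers of the coordinates `y_i - x_i` are generated by the obvious ones. -/
theorem exists_antisymm_of_sum_mul_diagS_pow (M : ℕ)
    (p : Fin (n + 1) → Hypersurface f ⊗[A] MvPolynomial (Fin (n + 1)) A)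
    (hp : ∑ i, p i * diagS f i ^ M = 0) :
    ∃ q : Fin (n + 1) → Fin (n + 1) → Hypersurface f ⊗[A] MvPolynomial (Fin (n + 1)) A,
      (∀ i, q i i = 0) ∧ (∀ i j, q i j = -q j i) ∧
        ∀ i, p i = ∑ j, q i j * diagS f j ^ M := by
  obtain ⟨q, h0, h1, h2⟩ := exists_antisymm_of_sum_mul_eq_zero (n + 1)
    (fun i => (X i : MvPolynomial (Fin (n + 1)) (Hypersurface f)) ^ M) (fun i => taylor f (p i))
    (fun i _ h => X_pow_regular (J := {j | j < i}) M (lt_irrefl i) h)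
    (by simpa [taylor_diagS] using congrArg (taylor f) hp)
  refine ⟨fun i j => (taylorEquiv f).symm (q i j), fun i => by simp [h0], fun i j => ?_,
    fun i => ?_⟩
  · exact (congrArg _ (h1 i j)).trans (map_neg _ _)
  · have := congrArg (taylorEquiv f).symm (h2 i)
    rw [← taylorEquiv_apply, AlgEquiv.symm_apply_apply] at this
    simpa [taylorEquiv_symm_X] using this

theorem topCoeff_add (N : ℕ) (p q : Hypersurface f ⊗[A] MvPolynomial (Fin (n + 1)) A) :
    topCoeff f N (p + q) = topCoeff f N p + topCoeff f N q := by
  simp [topCoeff]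

theorem topCoeff_zero (N : ℕ) : topCoeff f N 0 = 0 := by
  simp [topCoeff]

theorem topCoeff_sum {ι : Type*} (N : ℕ) (I : Finset ι)
    (p : ι → Hypersurface f ⊗[A] MvPolynomial (Fin (n + 1)) A) :
    topCoeff f N (∑ i ∈ I, p i) = ∑ i ∈ I, topCoeff f N (p i) := by
  simp [topCoeff, coeff_sum]

theorem topCoeff_tmul_one_mul (N : ℕ) (r : Hypersurface f)
    (p : Hypersurface f ⊗[A] MvPolynomial (Fin (n + 1)) A) :
    topCoeff f N (r ⊗ₜ 1 * p) = r * topCoeff f N p := by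
  have : taylor f (r ⊗ₜ 1 : Hypersurface f ⊗[A] MvPolynomial (Fin (n + 1)) A) = C r :=
    (taylor f).commutes r
  rw [topCoeff, map_mul, this, coeff_C_mul, topCoeff]

theorem topCoeff_mul_diagS_pow (N K : ℕ) (i : Fin (n + 1)) (h : N < K)
    (p : Hypersurface f ⊗[A] MvPolynomial (Fin (n + 1)) A) :
    topCoeff f N (p * diagS f i ^ K) = 0 := by
  rw [topCoeff, map_mul, map_pow, taylor_diagS, X_pow_eq_monomial, coeff_mul_monomial', if_neg]
  simpa using h

theorem taylor_prod_diagS_pow (a : Fin (n + 1) → ℕ) :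
    taylor f (∏ i, diagS f i ^ a i) = monomial (Finsupp.equivFunOnFinite.symm a) 1 := by
  simp only [map_prod, map_pow, taylor_diagS, monomial_eq, map_one, one_mul]
  rw [Finsupp.prod_fintype _ _ (by simp)]
  rfl

theorem topCoeff_mul_prod_pow (N K : ℕ)
    (p : Hypersurface f ⊗[A] MvPolynomial (Fin (n + 1)) A) :
    topCoeff f (N + K) (p * (∏ i, diagS f i) ^ K) = topCoeff f N p := by
  rw [topCoeff, map_mul, ← Finset.prod_pow, taylor_prod_diagS_pow, topCoeff,
    show (Finsupp.equivFunOnFinite.symm fun _ : Fin (n + 1) => N + K) =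
      Finsupp.equivFunOnFinite.symm (fun _ => N) + Finsupp.equivFunOnFinite.symm fun _ => K by
        ext; simp, coeff_mul_monomial, mul_one]

theorem topCoeff_prod_pow (N : ℕ) (a : Fin (n + 1) → ℕ) :
    topCoeff f N (∏ i, diagS f i ^ a i) = if a = fun _ => N then 1 else 0 := by
  rw [topCoeff, taylor_prod_diagS_pow, coeff_monomial]
  simp only [EmbeddingLike.apply_eq_iff_eq]

/-- The pairing `(p, q) ↦ topCoeff f N (p * q)` induces a perfect duality on
`(R ⊗ S) / ((y_i - x_i)^{N+1})_i`; since `R ⊗ S` is generated by `1 ⊗ S` over `R`, it suffices to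
test with the elements `1 ⊗ g`. -/
theorem exists_eq_sum_of_topCoeff_eq_zero (N : ℕ)
    (p : Hypersurface f ⊗[A] MvPolynomial (Fin (n + 1)) A)
    (h : ∀ g, topCoeff f N (p * 1 ⊗ₜ g) = 0) :
    ∃ q : Fin (n + 1) → Hypersurface f ⊗[A] MvPolynomial (Fin (n + 1)) A,
      p = ∑ i, q i * diagS f i ^ (N + 1) := by
  have hQ : ∀ q, topCoeff f N (p * q) = 0 := by
    intro q
    induction q with
    | zero => rw [mul_zero, topCoeff_zero]
    | add q q' hq hq' => rw [mul_add, topCoeff_add, hq, hq', add_zero]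
    | tmul r g =>
      have : r ⊗ₜ[A] g = (r ⊗ₜ 1) * (1 ⊗ₜ g) := by simp
      rw [this, mul_left_comm, topCoeff_tmul_one_mul, h, mul_zero]
  have hmem : taylor f p ∈ Ideal.span ((fun j => (X j : MvPolynomial (Fin (n + 1))
      (Hypersurface f)) ^ (N + 1)) '' Set.univ) := by
    rw [mem_span_X_pow_image_iff]
    intro a ha
    by_contra! hlt
    rw [mem_support_iff] at ha
    refine ha ?_
    have := hQ (∏ i, diagS f i ^ (N - a i))
    rw [topCoeff, map_mul, taylor_prod_diagS_pow,
      show (Finsupp.equivFunOnFinite.symm fun _ : Fin (n + 1) => N) =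
        a + Finsupp.equivFunOnFinite.symm fun i => N - a i by
          ext i
          have := hlt i (Set.mem_univ i)
          simp only [Finsupp.equivFunOnFinite_symm_apply_apply, Finsupp.add_apply]
          omega,
      coeff_mul_monomial, mul_one] at this
    exact this
  rw [Set.image_univ] at hmem
  obtain ⟨q, hq⟩ := Ideal.mem_span_range_iff_exists_fun.mp hmem
  refine ⟨fun i => (taylorEquiv f).symm (q i), taylor_injective f ?_⟩
  rw [← hq, map_sum]
  refine Finset.sum_congr rfl fun i _ => ?_
  rw [map_mul, map_pow, taylor_diagS, ← taylorEquiv_apply, AlgEquiv.apply_symm_apply]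

/-- `g(y) - g(x)` lies in the ideal of the diagonal. -/
theorem mem_span_diagS (g : MvPolynomial (Fin (n + 1)) A) :
    (1 ⊗ₜ g - toHypersurface f g ⊗ₜ 1 : Hypersurface f ⊗[A] MvPolynomial (Fin (n + 1)) A) ∈
      Ideal.span (Set.range (diagS f)) := by
  induction g using MvPolynomial.induction_on with
  | C a =>
    have h : (C a : MvPolynomial (Fin (n + 1)) A) = algebraMap A _ a := rfl
    rw [h, AlgHom.commutes, Algebra.algebraMap_eq_smul_one, Algebra.algebraMap_eq_smul_one,
      TensorProduct.tmul_smul, TensorProduct.smul_tmul', sub_self]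
    exact zero_mem _
  | add p q hp hq =>
    rw [map_add, TensorProduct.tmul_add, TensorProduct.add_tmul, add_sub_add_comm]
    exact add_mem hp hq
  | mul_X p i hp =>
    have : (1 ⊗ₜ (p * X i) - toHypersurface f (p * X i) ⊗ₜ 1 :
        Hypersurface f ⊗[A] MvPolynomial (Fin (n + 1)) A) =
        1 ⊗ₜ X i * (1 ⊗ₜ p - toHypersurface f p ⊗ₜ 1) +
          toHypersurface f p ⊗ₜ 1 * diagS f i := by
      simp only [diagS, coord, map_mul, mul_sub, Algebra.TensorProduct.tmul_mul_tmul, one_mul,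
        mul_one, mul_comm p, mul_comm (toHypersurface f p)]
      abel
    rw [this]
    exact add_mem (Ideal.mul_mem_left _ _ hp)
      (Ideal.mul_mem_left _ _ (Ideal.subset_span ⟨i, rfl⟩))

theorem topCoeff_eq_zero_of_mem_pow {N K : ℕ} (hK : (n + 1) * N < K)
    {p : Hypersurface f ⊗[A] MvPolynomial (Fin (n + 1)) A}
    (hp : p ∈ Ideal.span (Set.range (diagS f)) ^ K) : topCoeff f N p = 0 := by
  have hmap : taylor f p ∈ idealOfVars (Fin (n + 1)) (Hypersurface f) ^ K := by
    have h := Ideal.mem_map_of_mem (taylor f) hp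
    rw [Ideal.map_pow, Ideal.map_span, ← Set.range_comp] at h
    have e : ⇑(taylor f) ∘ diagS f = X := funext (taylor_diagS f)
    rwa [e] at h
  rw [mem_pow_idealOfVars_iff'] at hmap
  refine hmap _ ?_
  rw [Finsupp.degree_eq_sum]
  simpa using hK

theorem toHypersurface_surjective : Function.Surjective (toHypersurface f) :=
  Ideal.Quotient.mkₐ_surjective A (Ideal.span {f})

theorem proj_tmul (r : Hypersurface f) (g : MvPolynomial (Fin (n + 1)) A) :
    proj f (r ⊗ₜ g) = r ⊗ₜ toHypersurface f g := rfl

/-- The kernel of the multiplication map `R ⊗ R → R` is generated by the `y_i - x_i`. -/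
theorem span_diagR_eq_ker_lmul' :
    Ideal.span (Set.range (diagR f)) =
      RingHom.ker (Algebra.TensorProduct.lmul' A (S := Hypersurface f)) := by
  refine le_antisymm (Ideal.span_le.mpr ?_) fun x hx => ?_
  · rintro _ ⟨i, rfl⟩
    simp [diagR]
  · have key : ∀ y : Hypersurface f ⊗[A] Hypersurface f,
        y - Algebra.TensorProduct.lmul' A (S := Hypersurface f) y ⊗ₜ 1 ∈
          Ideal.span (Set.range (diagR f)) := by
      intro y
      induction y with
      | zero => simp
      | add a b ha hb =>
        rw [map_add, TensorProduct.add_tmul, add_sub_add_comm]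
        exact add_mem ha hb
      | tmul a b =>
        obtain ⟨g, rfl⟩ := toHypersurface_surjective f b
        have h := Ideal.mem_map_of_mem (proj f) (mem_span_diagS f g)
        rw [Ideal.map_span, ← Set.range_comp,
          show ⇑(proj f) ∘ diagS f = diagR f from funext (proj_diagS f)] at h
        have h' := Ideal.mul_mem_left _ (a ⊗ₜ 1) h
        rwa [map_sub, proj_tmul, proj_tmul, mul_sub, Algebra.TensorProduct.tmul_mul_tmul,
          Algebra.TensorProduct.tmul_mul_tmul, one_mul, mul_one, map_one, mul_one] at h'
    have := key x
    rwa [(RingHom.mem_ker).mp hx, TensorProduct.zero_tmul, sub_zero] at this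

end Taylor

/-! ### Top local cohomology of `R ⊗ S` and the residue -/

section Residue

open MvPolynomial CechTerm CechCochain

variable {A : Type*} [CommRing A] {n : ℕ} (f : MvPolynomial (Fin (n + 1)) A)

theorem topCochain_eq_ofFrac (N : ℕ) (p : Hypersurface f ⊗[A] MvPolynomial (Fin (n + 1)) A) :
    topCochain f N p = ofFrac (diagS f) (N + 1) (n + 1) fun _ => p := rfl

theorem topCochain_univ (N : ℕ) (p : Hypersurface f ⊗[A] MvPolynomial (Fin (n + 1)) A) :
    topCochain f N p ⟨Finset.univ, Finset.card_fin _⟩ =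
      frac (diagS f) Finset.univ (N + 1) p := rfl

theorem eq_univ_of_card (s : {s : Finset (Fin (n + 1)) // s.card = n + 1}) :
    s = ⟨Finset.univ, Finset.card_fin _⟩ :=
  Subtype.ext (eq_univ_of_card_eq_succ s.2)

theorem ofFrac_eq_topCochain (N : ℕ)
    (β : Finset (Fin (n + 1)) → Hypersurface f ⊗[A] MvPolynomial (Fin (n + 1)) A) :
    ofFrac (diagS f) (N + 1) (n + 1) β = topCochain f N (β Finset.univ) := by
  funext s
  rw [eq_univ_of_card s]
  rfl

theorem exists_eq_topCochain (x : CechCochain (diagS f) (n + 1)) :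
    ∃ N p, x = topCochain f N p := by
  obtain ⟨M, β, hM, rfl⟩ := exists_eq_ofFrac x 1
  obtain ⟨N, rfl⟩ := Nat.exists_eq_add_of_le' hM
  exact ⟨N, _, ofFrac_eq_topCochain f N β⟩

theorem topCochain_add_exp (N K : ℕ) (p : Hypersurface f ⊗[A] MvPolynomial (Fin (n + 1)) A) :
    topCochain f (N + K) (p * (∏ i, diagS f i) ^ K) = topCochain f N p := by
  funext s
  rw [eq_univ_of_card s, topCochain_univ, topCochain_univ, ← frac_add_exp _ _ (N + 1) K,
    Nat.add_right_comm]

theorem smul_topCochain (N : ℕ) (q p : Hypersurface f ⊗[A] MvPolynomial (Fin (n + 1)) A) :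
    q • topCochain f N p = topCochain f N (q * p) := by
  rw [topCochain_eq_ofFrac, smul_ofFrac]
  rfl

theorem topCochain_add (N : ℕ) (p q : Hypersurface f ⊗[A] MvPolynomial (Fin (n + 1)) A) :
    topCochain f N (p + q) = topCochain f N p + topCochain f N q :=
  funext fun s => frac_add (diagS f) s.1 (N + 1) p q

theorem topCoeff_eq_of_topCochain_eq {N N' : ℕ}
    {p p' : Hypersurface f ⊗[A] MvPolynomial (Fin (n + 1)) A}
    (h : topCochain f N p = topCochain f N' p') : topCoeff f N p = topCoeff f N' p' := by
  rw [← topCochain_add_exp f N N', ← topCochain_add_exp f N' N, Nat.add_comm N'] at h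
  have h1 := frac_inj (diagS f) Finset.univ (diagS_mem_nonZeroDivisors f)
    (congrFun h ⟨Finset.univ, Finset.card_fin _⟩)
  rw [← topCoeff_mul_prod_pow f N N', h1, Nat.add_comm, topCoeff_mul_prod_pow]

/-- The residue `C^{n+1}(R ⊗ S) → R`: the coefficient of `∏_i (y_i - x_i)^{-1}` in an element of
`(R ⊗ S)[∏_i (y_i - x_i)^{-1}]`. -/
noncomputable def residue : CechCochain (diagS f) (n + 1) →+ Hypersurface f :=
  AddMonoidHom.mk' (fun x => topCoeff f (exists_eq_topCochain f x).choose
    (exists_eq_topCochain f x).choose_spec.choose) (by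
      intro x y
      have hx := (exists_eq_topCochain f x).choose_spec.choose_spec
      have hy := (exists_eq_topCochain f y).choose_spec.choose_spec
      have hxy := (exists_eq_topCochain f (x + y)).choose_spec.choose_spec
      generalize (exists_eq_topCochain f x).choose_spec.choose = p at hx ⊢
      generalize (exists_eq_topCochain f x).choose = N at hx ⊢
      generalize (exists_eq_topCochain f y).choose_spec.choose = q at hy ⊢
      generalize (exists_eq_topCochain f y).choose = K at hy ⊢
      rw [← topCoeff_mul_prod_pow f N K p, ← topCoeff_mul_prod_pow f K N q, Nat.add_comm K,
        ← topCoeff_add]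
      refine topCoeff_eq_of_topCochain_eq f ?_
      rw [← hxy, topCochain_add, topCochain_add_exp, Nat.add_comm N K, topCochain_add_exp, hx, hy])

theorem residue_topCochain (N : ℕ) (p : Hypersurface f ⊗[A] MvPolynomial (Fin (n + 1)) A) :
    residue f (topCochain f N p) = topCoeff f N p :=
  (topCoeff_eq_of_topCochain_eq f
    (exists_eq_topCochain f (topCochain f N p)).choose_spec.choose_spec).symm

theorem koszulOp_eq_residue (N : ℕ) (p : Hypersurface f ⊗[A] MvPolynomial (Fin (n + 1)) A)
    (g : MvPolynomial (Fin (n + 1)) A) :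
    koszulOp f N p g = residue f
      ((1 ⊗ₜ g : Hypersurface f ⊗[A] MvPolynomial (Fin (n + 1)) A) • topCochain f N p) := by
  rw [smul_topCochain, residue_topCochain, koszulOp, mul_comm]

/-- The residue factors through `H^{n+1}(R ⊗ S)`. -/
theorem residue_cechD (v : CechCochain (diagS f) n) : residue f (cechD (diagS f) n v) = 0 := by
  obtain ⟨M, β, hM, rfl⟩ := exists_eq_ofFrac v 1
  obtain ⟨N, rfl⟩ := Nat.exists_eq_add_of_le' hM
  rw [cechD_ofFrac, ofFrac_eq_topCochain, residue_topCochain, topCoeff_sum]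
  refine Finset.sum_eq_zero fun i _ => ?_
  rw [← mul_assoc, topCoeff_mul_diagS_pow f N (N + 1) i (Nat.lt_succ_self N)]

theorem exists_cechD_eq_topCochain (N : ℕ)
    (q : Fin (n + 1) → Hypersurface f ⊗[A] MvPolynomial (Fin (n + 1)) A) :
    ∃ v, topCochain f N (∑ i, q i * diagS f i ^ (N + 1)) = cechD (diagS f) n v := by
  obtain ⟨v, hv⟩ := ofFrac_sum_eq_cechD (diagS f) (N + 1) q
  exact ⟨v, by rw [← hv, ofFrac_eq_topCochain]⟩

/-- The elements of `H^{n+1}(R ⊗ S)` are detected by the residues of their `1 ⊗ S`-multiples. -/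
theorem exists_eq_cechD_of_residue_eq_zero (x : CechCochain (diagS f) (n + 1))
    (h : ∀ g : MvPolynomial (Fin (n + 1)) A,
      residue f ((1 ⊗ₜ g : Hypersurface f ⊗[A] MvPolynomial (Fin (n + 1)) A) • x) = 0) :
    ∃ v, x = cechD (diagS f) n v := by
  obtain ⟨N, p, rfl⟩ := exists_eq_topCochain f x
  simp only [← koszulOp_eq_residue] at h
  obtain ⟨q, rfl⟩ := exists_eq_sum_of_topCoeff_eq_zero f N p h
  exact exists_cechD_eq_topCochain f N q

end Residue

/-! ### Vanishing of `H^n` of `R ⊗ S` -/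

section Vanishing

open MvPolynomial CechTerm CechCochain

/-- The Čech complex of `R ⊗ S` on the `n + 1` elements `y_i - x_i` is exact in degree `n`. -/
theorem mem_cechCoboundaries_of_cechD_eq_zero {A : Type*} [CommRing A] {n : ℕ}
    (f : MvPolynomial (Fin (n + 1)) A) {c : CechCochain (diagS f) n}
    (hc : cechD (diagS f) n c = 0) : c ∈ cechCoboundaries (diagS f) n := by
  obtain ⟨M, β, -, rfl⟩ := exists_eq_ofFrac c 0
  obtain ⟨q, hq0, hq1, hq⟩ := exists_antisymm_of_sum_mul_diagS_pow f M _
    (sum_mul_pow_eq_zero_of_cechD_eq_zero (diagS_mem_nonZeroDivisors f) hc)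
  cases n with
  | zero =>
    change _ = 0
    have h0 := hq 0
    rw [Fin.sum_univ_one, hq0] at h0
    funext s
    obtain ⟨i, hi⟩ := exists_eq_erase_of_card s.2
    obtain rfl : i = 0 := Fin.eq_zero i
    have : β s.1 = 0 := by
      rw [hi]
      simpa using h0
    simp only [ofFrac, this, frac_zero, Pi.zero_apply]
  | succ k =>
    obtain ⟨b, hb⟩ := exists_cechD_eq_ofFrac hq0 hq1 hq
    exact ⟨b, hb⟩

end Vanishing

/-! ### The connecting homomorphism -/

section Connecting

open MvPolynomial CechTerm CechCochain

variable {A : Type*} [CommRing A] {n : ℕ} {f : MvPolynomial (Fin (n + 1)) A}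

theorem proj_surjective : Function.Surjective (proj f) :=
  TensorProduct.map_surjective Function.surjective_id (toHypersurface_surjective f)

/-- `R ⊗ S → R ⊗ R` is the quotient by `f(y)`. -/
theorem exists_eq_fy_mul_of_proj_eq_zero
    (p : Hypersurface f ⊗[A] MvPolynomial (Fin (n + 1)) A) (hp : proj f p = 0) :
    ∃ q, p = fy f * q := by
  have h : p ∈ RingHom.ker (proj f) := hp
  have hk : RingHom.ker (toHypersurface f) = Ideal.span {f} := Ideal.Quotient.mkₐ_ker A _
  rw [proj, Algebra.TensorProduct.lTensor_ker _ (toHypersurface_surjective f), hk,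
    Ideal.map_span, Set.image_singleton] at h
  obtain ⟨q, hq⟩ := Ideal.mem_span_singleton'.mp h
  exact ⟨q, by rw [← hq, mul_comm]; rfl⟩

theorem cechD_eq_zero_of_mem_cechCoboundaries {R R' : Type*} [CommRing R] [Algebra A R]
    [CommRing R'] [Algebra A R'] {m : ℕ} {z : Fin m → R ⊗[A] R'} {k : ℕ} {c : CechCochain z k}
    (hc : c ∈ cechCoboundaries z k) : cechD z k c = 0 := by
  cases k with
  | zero =>
    obtain rfl : c = 0 := hc
    exact map_zero _
  | succ k =>
    obtain ⟨b, rfl⟩ := hc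
    exact cechD_cechD k b

/-- The projection `R ⊗ S → R ⊗ R` on Čech cochains. -/
noncomputable abbrev mapProj (f : MvPolynomial (Fin (n + 1)) A) (k : ℕ) :
    CechCochain (diagS f) k → CechCochain (diagR f) k :=
  CechCochain.map (proj f) (diagS f) (diagR f) (proj_diagS f) k

theorem mapProj_mem_cechCoboundaries {k : ℕ} {c : CechCochain (diagS f) k}
    (hc : c ∈ cechCoboundaries (diagS f) k) : mapProj f k c ∈ cechCoboundaries (diagR f) k := by
  cases k with
  | zero =>
    obtain rfl : c = 0 := hc
    exact funext fun s => _root_.map_zero _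
  | succ k =>
    obtain ⟨b, rfl⟩ := hc
    exact ⟨mapProj f k b, (map_cechD (proj_diagS f) k b).symm⟩

theorem exists_mapProj_eq_of_mem_cechCoboundaries {k : ℕ} {c : CechCochain (diagR f) k}
    (hc : c ∈ cechCoboundaries (diagR f) k) :
    ∃ c' ∈ cechCoboundaries (diagS f) k, mapProj f k c' = c := by
  cases k with
  | zero =>
    obtain rfl : c = 0 := hc
    exact ⟨0, zero_mem _, funext fun s => _root_.map_zero _⟩
  | succ k =>
    obtain ⟨b, rfl⟩ := hc
    obtain ⟨b', rfl⟩ := map_surjective (proj_diagS f) proj_surjective k b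
    exact ⟨_, ⟨b', rfl⟩, map_cechD (proj_diagS f) k b'⟩

/-- Every cocycle over `R ⊗ R` has an image under the connecting homomorphism. -/
theorem exists_connectsTo {c : CechCochain (diagR f) n} (hc : cechD (diagR f) n c = 0) :
    ∃ N p, ConnectsTo f c N p := by
  obtain ⟨c', rfl⟩ := map_surjective (proj_diagS f) proj_surjective n c
  rw [← map_cechD] at hc
  obtain ⟨v, hv⟩ := exists_smul_of_map_eq_zero (proj_diagS f) exists_eq_fy_mul_of_proj_eq_zero hc
  obtain ⟨N, p, rfl⟩ := exists_eq_topCochain f v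
  exact ⟨N, p, c', rfl, hv⟩

theorem proj_fy : proj f (fy f) = 0 := by
  have : toHypersurface f f = 0 :=
    Ideal.Quotient.eq_zero_iff_mem.mpr (Ideal.mem_span_singleton_self f)
  rw [fy, proj_tmul, this, TensorProduct.tmul_zero]

theorem ConnectsTo.cechD_eq_zero {c : CechCochain (diagR f) n} {N : ℕ}
    {p : Hypersurface f ⊗[A] MvPolynomial (Fin (n + 1)) A} (h : ConnectsTo f c N p) :
    cechD (diagR f) n c = 0 := by
  obtain ⟨c', rfl, h⟩ := h
  rw [← map_cechD, h, map_smul_of_eq_zero _ proj_fy]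

/-- The image of the connecting homomorphism is killed by `f(y)`, so the operator `S → R` attached
to it vanishes on the ideal `(f)` and descends to `R`. -/
theorem ConnectsTo.koszulOp_mul_eq_zero {c : CechCochain (diagR f) n} {N : ℕ}
    {p : Hypersurface f ⊗[A] MvPolynomial (Fin (n + 1)) A} (h : ConnectsTo f c N p)
    (g : MvPolynomial (Fin (n + 1)) A) : koszulOp f N p (g * f) = 0 := by
  obtain ⟨c', -, h⟩ := h
  have : (1 ⊗ₜ (g * f) : Hypersurface f ⊗[A] MvPolynomial (Fin (n + 1)) A) =
      1 ⊗ₜ g * fy f := by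
    rw [fy, Algebra.TensorProduct.tmul_mul_tmul, one_mul]
  rw [koszulOp_eq_residue, this, CechCochain.mul_smul, ← h, ← map_smul, residue_cechD]

theorem ConnectsTo.sub {c d : CechCochain (diagR f) n} {N K : ℕ}
    {p q : Hypersurface f ⊗[A] MvPolynomial (Fin (n + 1)) A} (hc : ConnectsTo f c N p)
    (hd : ConnectsTo f d K q) :
    ∃ L r, ConnectsTo f (c - d) L r ∧
      ∀ g, koszulOp f L r g = koszulOp f N p g - koszulOp f K q g := by
  obtain ⟨c', rfl, hc⟩ := hc
  obtain ⟨d', rfl, hd⟩ := hd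
  obtain ⟨L, r, hL⟩ := exists_eq_topCochain f (topCochain f N p - topCochain f K q)
  refine ⟨L, r, ⟨c' - d', CechCochain.map_sub _ _ _ _, ?_⟩, fun g => ?_⟩
  · rw [_root_.map_sub, hc, hd, ← hL, CechCochain.smul_sub]
  · simp only [koszulOp_eq_residue, ← hL, CechCochain.smul_sub, _root_.map_sub]

/-- The operator attached to `c` depends only on the class of `c`. Here `f(y)` must be a
nonzerodivisor, to be cancelled from `f(y) p / ∏_i (y_i - x_i)^{N+1}`. -/
theorem ConnectsTo.koszulOp_eq_zero_of_mem_cechCoboundaries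
    (hfy : fy f ∈ nonZeroDivisors (Hypersurface f ⊗[A] MvPolynomial (Fin (n + 1)) A))
    {c : CechCochain (diagR f) n} {N : ℕ}
    {p : Hypersurface f ⊗[A] MvPolynomial (Fin (n + 1)) A} (h : ConnectsTo f c N p)
    (hc : c ∈ cechCoboundaries (diagR f) n) (g : MvPolynomial (Fin (n + 1)) A) :
    koszulOp f N p g = 0 := by
  obtain ⟨c', rfl, h⟩ := h
  obtain ⟨c₀, hc₀, h₀⟩ := exists_mapProj_eq_of_mem_cechCoboundaries hc
  obtain ⟨v, hv⟩ := exists_smul_of_map_eq_zero (proj_diagS f) exists_eq_fy_mul_of_proj_eq_zero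
    (c := c' - c₀) (by rw [CechCochain.map_sub, sub_eq_zero, ← h₀])
  have h1 : fy f • (topCochain f N p - cechD (diagS f) n v) = 0 := by
    rw [CechCochain.smul_sub, ← h, ← map_smul, ← hv, _root_.map_sub,
      cechD_eq_zero_of_mem_cechCoboundaries hc₀, sub_zero, sub_self]
  have h2 : topCochain f N p = cechD (diagS f) n v := by
    rw [← sub_eq_zero]
    funext s
    exact (smul_eq_zero_iff_of_mem_nonZeroDivisors _ _ hfy).mp (congrFun h1 s)
  rw [koszulOp_eq_residue, h2, ← map_smul, residue_cechD]

/-- The connecting homomorphism, followed by the duality between `H^{n+1}(R ⊗ S)` and differential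
operators, is injective. -/
theorem ConnectsTo.mem_cechCoboundaries_of_koszulOp_eq_zero
    {c : CechCochain (diagR f) n} {N : ℕ}
    {p : Hypersurface f ⊗[A] MvPolynomial (Fin (n + 1)) A} (h : ConnectsTo f c N p)
    (h0 : ∀ g, koszulOp f N p g = 0) : c ∈ cechCoboundaries (diagR f) n := by
  obtain ⟨c', rfl, h⟩ := h
  simp only [koszulOp_eq_residue] at h0
  obtain ⟨v, hv⟩ := exists_eq_cechD_of_residue_eq_zero f _ h0
  have h1 : cechD (diagS f) n (c' - fy f • v) = 0 := by
    rw [_root_.map_sub, map_smul, ← hv, h, sub_self]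
  have h2 := mapProj_mem_cechCoboundaries (mem_cechCoboundaries_of_cechD_eq_zero f h1)
  rwa [mapProj, CechCochain.map_sub, map_smul_of_eq_zero _ proj_fy, sub_zero] at h2

end Connecting

/-! ### The action of differential operators on Čech cochains -/

section Action

/-- If `T` acts through a map `φ : T → T'`, differential operators over `T'` are differential
operators over `T`. -/
theorem OrderLT.of_smul_eq {A T T' M N : Type*} [CommRing A] [CommRing T] [Algebra A T]
    [CommRing T'] [Algebra A T'] [AddCommGroup M] [Module A M] [Module T M] [IsScalarTower A T M]
    [Module T' M] [IsScalarTower A T' M] [AddCommGroup N] [Module A N] [Module T N]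
    [IsScalarTower A T N] [Module T' N] [IsScalarTower A T' N] (φ : T → T')
    (hM : ∀ (t : T) (x : M), t • x = φ t • x) (hN : ∀ (t : T) (x : N), t • x = φ t • x) {k : ℕ} :
    ∀ {δ : M →ₗ[A] N}, OrderLT T' k δ → OrderLT T k δ := by
  induction k with
  | zero => exact fun h => h
  | succ k ih =>
    intro δ h t
    have : commutator t δ = commutator (φ t) δ := by
      ext x
      simp [hM, hN]
    rw [this]
    exact ih (h (φ t))

/-- Differential operators on localizations of `T` and `T'` that are compatible on `T` are
compatible. -/
theorem OrderLT.map_eq_of_localization {A T L T' L' : Type*} [CommRing A] [CommRing T]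
    [Algebra A T] [CommRing L] [Algebra T L] [Algebra A L] [IsScalarTower A T L] [CommRing T']
    [Algebra A T'] [CommRing L'] [Algebra T' L'] [Algebra A L'] [IsScalarTower A T' L']
    (W : Submonoid T) [IsLocalization W L] (φ : T →ₐ[A] T') (g : L →+* L')
    (hg : ∀ t, g (algebraMap T L t) = algebraMap T' L' (φ t)) {k k' : ℕ} {δ : L →ₗ[A] L}
    {δ' : L' →ₗ[A] L'} (hδ : OrderLT T k δ) (hδ' : OrderLT T' k' δ')
    (h : ∀ t, g (δ (algebraMap T L t)) = δ' (algebraMap T' L' (φ t))) (x : L) :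
    g (δ x) = δ' (g x) := by
  let _ : Algebra T L' := ((algebraMap T' L').comp (φ : T →+* T')).toAlgebra
  have halg : ∀ t, algebraMap T L' t = algebraMap T' L' (φ t) := fun _ => rfl
  have : IsScalarTower A T L' := IsScalarTower.of_algebraMap_eq fun a => by
    rw [halg, AlgHom.commutes, ← IsScalarTower.algebraMap_apply]
  let g' : L →ₐ[T] L' := { g with commutes' := hg }
  let g'' : L →ₗ[A] L' := g'.toLinearMap.restrictScalars A
  have hg'' : ∀ (t : T) (x : L), g'' (t • x) = t • g'' x := fun t x => map_smul g' t x
  have hδ'' : OrderLT T k' δ' := OrderLT.of_smul_eq φ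
    (fun t x => by rw [Algebra.smul_def, Algebra.smul_def, halg])
    (fun t x => by rw [Algebra.smul_def, Algebra.smul_def, halg]) hδ'
  have h0 : g'' ∘ₗ δ - δ' ∘ₗ g'' = 0 := by
    refine OrderLT.eq_zero_of_localization (T := T) (n := max k k') W ?_
      (((OrderLT.post g'' hg'' hδ).mono (le_max_left _ _)).sub
        ((OrderLT.pre g'' hg'' hδ'').mono (le_max_right _ _))) fun t => ?_
    · intro w hw y hy
      rw [Algebra.smul_def, halg, ← hg] at hy
      exact ((IsLocalization.map_units L ⟨w, hw⟩).map g).mul_right_eq_zero.mp hy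
    · have e1 : g'' (δ (algebraMap T L t)) = δ' (algebraMap T' L' (φ t)) := h t
      have e2 : g'' (algebraMap T L t) = algebraMap T' L' (φ t) := hg t
      rw [LinearMap.sub_apply, LinearMap.comp_apply, LinearMap.comp_apply, e1, e2, sub_self]
  exact sub_eq_zero.mp (LinearMap.congr_fun h0 x)

variable {A R R' : Type*} [CommRing A] [CommRing R] [Algebra A R] [CommRing R'] [Algebra A R']
  {m : ℕ}

theorem smul_algebraMap_tmul (z : Fin m → R ⊗[A] R') (s : Finset (Fin m)) (δ : diffOps A R R)
    (r : R) (r' : R') :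
    δ • algebraMap (R ⊗[A] R') (CechTerm z s) (r ⊗ₜ r') =
      algebraMap (R ⊗[A] R') (CechTerm z s) (δ.1 r ⊗ₜ r') := by
  rw [smul_cechTerm, localize_algebraMap, extendLeft_tmul]

/-- The action of `D_{R|A}` on the localizations of `R ⊗ R'` is natural in `R'`. -/
theorem CechTerm.map_smul_diffOps {R'' : Type*} [CommRing R''] [Algebra A R''] (ψ : R' →ₐ[A] R'')
    {z : Fin m → R ⊗[A] R'} {z' : Fin m → R ⊗[A] R''}
    (h : ∀ i, Algebra.TensorProduct.map (AlgHom.id A R) ψ (z i) = z' i) (s : Finset (Fin m))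
    (δ : diffOps A R R) (x : CechTerm z s) :
    CechTerm.map (Algebra.TensorProduct.map (AlgHom.id A R) ψ) z z' h s (δ • x) =
      δ • CechTerm.map (Algebra.TensorProduct.map (AlgHom.id A R) ψ) z z' h s x := by
  obtain ⟨k, hk⟩ := (localize A (R ⊗[A] R') (CechTerm z s) (Submonoid.powers (∏ i ∈ s, z i))
    (extendLeft A R R' δ)).2
  obtain ⟨k', hk'⟩ := (localize A (R ⊗[A] R'') (CechTerm z' s)
    (Submonoid.powers (∏ i ∈ s, z' i)) (extendLeft A R R'' δ)).2
  have hc : ∀ q, CechTerm.map (Algebra.TensorProduct.map (AlgHom.id A R) ψ) z z' h s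
      (algebraMap _ _ q) =
        algebraMap _ _ (Algebra.TensorProduct.map (AlgHom.id A R) ψ q) :=
    fun q => IsLocalization.Away.lift_eq _ _ q
  refine OrderLT.map_eq_of_localization (Submonoid.powers (∏ i ∈ s, z i))
    (Algebra.TensorProduct.map (AlgHom.id A R) ψ) _ hc hk hk' (fun t => ?_) x
  rw [localize_algebraMap, localize_algebraMap, hc]
  congr 1
  induction t with
  | zero => simp only [_root_.map_zero]
  | add a b ha hb => simp only [_root_.map_add, ha, hb]
  | tmul r r' =>
    rw [extendLeft_tmul, Algebra.TensorProduct.map_tmul, Algebra.TensorProduct.map_tmul,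
      extendLeft_tmul]
    rfl

/-- The commutator `[r, δ]` of a differential operator with multiplication by `r`, as a differential
operator. -/
def bracket (r : R) (δ : diffOps A R R) : diffOps A R R :=
  ⟨commutator r δ.1, δ.2.imp fun _ h => h.succ r⟩

theorem bracket_one (δ : diffOps A R R) : bracket 1 δ = 0 := by
  refine Subtype.ext (LinearMap.ext fun x => ?_)
  change (1 : R) • δ.1 x - δ.1 ((1 : R) • x) = 0
  rw [one_smul, one_smul, sub_self]

/-- On the localizations of `R ⊗ R'`, the commutator of `δ` with multiplication by `r ⊗ r'` is
`(1 ⊗ r') ∘ [r, δ]`. -/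
theorem CechTerm.tmul_smul_sub_smul_tmul (z : Fin m → R ⊗[A] R') (s : Finset (Fin m))
    (δ : diffOps A R R) (r : R) (r' : R') (x : CechTerm z s) :
    (r ⊗ₜ[A] r') • (δ • x) - δ • ((r ⊗ₜ[A] r') • x) =
      ((1 : R) ⊗ₜ[A] r') • (bracket r δ • x) := by
  obtain ⟨k, hk⟩ := (localize A (R ⊗[A] R') (CechTerm z s) (Submonoid.powers (∏ i ∈ s, z i))
    (extendLeft A R R' δ)).2
  obtain ⟨k', hk'⟩ := (localize A (R ⊗[A] R') (CechTerm z s) (Submonoid.powers (∏ i ∈ s, z i))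
    (extendLeft A R R' (bracket r δ))).2
  have hpost : ∀ (t : R ⊗[A] R') (y : CechTerm z s),
      Algebra.lsmul A A (CechTerm z s) ((1 : R) ⊗ₜ[A] r') (t • y) =
        t • Algebra.lsmul A A (CechTerm z s) ((1 : R) ⊗ₜ[A] r') y := fun t y => by
    simp only [Algebra.lsmul_coe]
    exact smul_comm _ _ _
  have h0 := OrderLT.eq_zero_of_localization (T := R ⊗[A] R') (n := max k k')
    (Submonoid.powers (∏ i ∈ s, z i)) (fun w hw y hy => by
      rw [Algebra.smul_def] at hy
      exact (IsLocalization.map_units (CechTerm z s) ⟨w, hw⟩).mul_right_eq_zero.mp hy)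
    (((hk.succ (r ⊗ₜ[A] r')).mono (le_max_left _ _)).sub
      ((OrderLT.post _ hpost hk').mono (le_max_right _ _))) (fun t => by
      rw [LinearMap.sub_apply, commutator_apply, LinearMap.comp_apply, Algebra.lsmul_coe,
        Algebra.smul_def (r ⊗ₜ[A] r') (algebraMap _ (CechTerm z s) t), ← map_mul,
        localize_algebraMap, localize_algebraMap, localize_algebraMap, Algebra.smul_def]
      beta_reduce
      rw [Algebra.smul_def, ← map_mul, ← map_mul, ← map_sub, ← map_sub]
      convert map_zero (algebraMap (R ⊗[A] R') (CechTerm z s))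
      induction t with
      | zero => simp only [mul_zero, map_zero, sub_zero]
      | add a b ha hb =>
        simp only [mul_add, map_add]
        rw [← add_zero (0 : R ⊗[A] R')]
        nth_rw 1 [← ha]
        rw [← hb]
        abel
      | tmul a b =>
        simp only [Algebra.TensorProduct.tmul_mul_tmul, extendLeft_tmul, one_mul]
        rw [← TensorProduct.sub_tmul, ← TensorProduct.sub_tmul]
        have : (bracket r δ).1 a = r * δ.1 a - δ.1 (r * a) := rfl
        rw [this, sub_self, TensorProduct.zero_tmul])
  exact sub_eq_zero.mp (LinearMap.congr_fun h0 x)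

variable {z : Fin m → R ⊗[A] R'} {k : ℕ}

theorem CechCochain.one_tmul_smul_comm (δ : diffOps A R R) (r' : R') (c : CechCochain z k) :
    ((1 : R) ⊗ₜ[A] r') • (δ • c) = δ • (((1 : R) ⊗ₜ[A] r') • c) := by
  funext s
  have h := CechTerm.tmul_smul_sub_smul_tmul z s.1 δ 1 r' (c s)
  rw [bracket_one, zero_smul] at h
  exact sub_eq_zero.mp (h.trans (smul_zero _))

/-- The commutator of `δ` with multiplication by `1 ⊗ r' - r ⊗ 1` is `-[r, δ]`. -/
theorem CechCochain.one_tmul_sub_tmul_one_smul (δ : diffOps A R R) (r : R) (r' : R')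
    (c : CechCochain z k) :
    ((1 : R) ⊗ₜ[A] r' - r ⊗ₜ[A] (1 : R')) • (δ • c) =
      δ • (((1 : R) ⊗ₜ[A] r' - r ⊗ₜ[A] (1 : R')) • c) - bracket r δ • c := by
  have h1 := CechCochain.one_tmul_smul_comm δ r' c
  have h2 : (r ⊗ₜ[A] (1 : R')) • (δ • c) - δ • ((r ⊗ₜ[A] (1 : R')) • c) = bracket r δ • c := by
    funext s
    exact (CechTerm.tmul_smul_sub_smul_tmul z s.1 δ r 1 (c s)).trans (one_smul _ _)
  have e : ∀ d : CechCochain z k, ((1 : R) ⊗ₜ[A] r' - r ⊗ₜ[A] (1 : R')) • d =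
      ((1 : R) ⊗ₜ[A] r') • d - (r ⊗ₜ[A] (1 : R')) • d := fun d => sub_smul _ _ d
  rw [e, e, smul_sub δ, h1, ← h2]
  abel

theorem cechD_smul_diffOps (δ : diffOps A R R) (c : CechCochain z k) :
    cechD z k (δ • c) = δ • cechD z k c :=
  (cechDD z k).map_smul δ c

end Action

section ConnectsToSMul

open MvPolynomial

variable {A : Type*} [CommRing A] {n : ℕ} {f : MvPolynomial (Fin (n + 1)) A}

/-- The connecting homomorphism is `D_{R|A}`-linear. -/
theorem ConnectsTo.smul {c : CechCochain (diagR f) n} {N : ℕ}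
    {p : Hypersurface f ⊗[A] MvPolynomial (Fin (n + 1)) A} (h : ConnectsTo f c N p)
    (δ : diffOps A (Hypersurface f) (Hypersurface f)) :
    ∃ K q, ConnectsTo f (δ • c) K q ∧ topCochain f K q = δ • topCochain f N p := by
  obtain ⟨c', rfl, h⟩ := h
  obtain ⟨K, q, hq⟩ := exists_eq_topCochain f (δ • topCochain f N p)
  refine ⟨K, q, ⟨δ • c', ?_, ?_⟩, hq.symm⟩
  · funext s
    exact CechTerm.map_smul_diffOps (toHypersurface f) (proj_diagS f) s.1 δ (c' s)
  · rw [cechD_smul_diffOps, h, ← hq, fy, CechCochain.one_tmul_smul_comm]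

end ConnectsToSMul

/-! ### Residues commute with differential operators -/

section Inverses

open CechTerm CechCochain

variable {T : Type*} [CommRing T] {n : ℕ}

/-- The element `1 / z_i` of the top Čech term, which is a ring. -/
noncomputable def invCochain (z : Fin (n + 1) → T) (i : Fin (n + 1)) : CechCochain z (n + 1) :=
  ofFrac z 1 (n + 1) fun s => ∏ j ∈ s.erase i, z j

variable (z : Fin (n + 1) → T)

theorem algebraMap_mul_invCochain (i : Fin (n + 1)) :
    algebraMap T (CechCochain z (n + 1)) (z i) * invCochain z i = 1 := by
  rw [← Algebra.smul_def, invCochain, smul_ofFrac]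
  funext s
  obtain ⟨s, hs⟩ := s
  obtain rfl := eq_univ_of_card_eq_succ hs
  simp only [ofFrac]
  rw [Finset.mul_prod_erase _ _ (Finset.mem_univ i), eq_comm, Pi.one_apply, eq_frac_iff, one_mul,
    pow_one]

theorem smul_invCochain_mul (i : Fin (n + 1)) (c : CechCochain z (n + 1)) :
    z i • (invCochain z i * c) = c := by
  rw [Algebra.smul_def, ← mul_assoc, algebraMap_mul_invCochain, one_mul]

/-- The monomial `∏_i z_i^{-a_i}`. -/
noncomputable def invMonomial (a : Fin (n + 1) → ℕ) : CechCochain z (n + 1) :=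
  ∏ i, invCochain z i ^ a i

theorem invMonomial_zero : invMonomial z 0 = 1 := by
  simp [invMonomial]

theorem invMonomial_add_single (a : Fin (n + 1) → ℕ) (i : Fin (n + 1)) :
    invMonomial z (a + Pi.single i 1) = invCochain z i * invMonomial z a := by
  simp only [invMonomial, Pi.add_apply, pow_add, Finset.prod_mul_distrib]
  rw [mul_comm]
  congr 1
  rw [Finset.prod_eq_single i]
  · simp
  · intro j _ hj
    simp [Pi.single_eq_of_ne hj]
  · simp

theorem smul_smul_invMonomial_add_single (q : T) (a : Fin (n + 1) → ℕ) (i : Fin (n + 1)) :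
    z i • q • invMonomial z (a + Pi.single i 1) = q • invMonomial z a := by
  rw [smul_comm, invMonomial_add_single, smul_invCochain_mul]

theorem invMonomial_mul_of_smul_eq_sub (a : Fin (n + 1) → ℕ) (i : Fin (n + 1))
    {x y w : CechCochain z (n + 1)} (h : z i • x = y - w) :
    invMonomial z a * x =
      invMonomial z (a + Pi.single i 1) * y - invMonomial z (a + Pi.single i 1) * w := by
  have e : x = invCochain z i * (z i • x) := by
    rw [mul_smul_comm, smul_invCochain_mul]
  rw [← mul_sub, ← h, invMonomial_add_single, mul_comm (invCochain z i), mul_assoc, ← e]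

theorem invMonomial_mul_smul_one (a : Fin (n + 1) → ℕ) (q : T) :
    invMonomial z a * (q • (1 : CechCochain z (n + 1))) = q • invMonomial z a := by
  rw [mul_smul_comm, mul_one]

theorem invMonomial_eq_ofFrac {a : Fin (n + 1) → ℕ} {N : ℕ} (h : ∀ i, a i ≤ N) :
    invMonomial z a = ofFrac z N (n + 1) fun _ => ∏ i, z i ^ (N - a i) := by
  have key : invMonomial z a * algebraMap T _ (∏ i, z i ^ N) =
      algebraMap T _ (∏ i, z i ^ (N - a i)) := by
    rw [map_prod, map_prod, invMonomial, ← Finset.prod_mul_distrib]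
    refine Finset.prod_congr rfl fun i _ => ?_
    rw [map_pow, map_pow, ← Nat.sub_add_cancel (h i), Nat.add_sub_cancel, pow_add, mul_comm,
      mul_assoc, ← mul_pow, algebraMap_mul_invCochain, one_pow, mul_one]
  funext s
  obtain ⟨s, hs⟩ := s
  obtain rfl := eq_univ_of_card_eq_succ hs
  have := congrFun key ⟨Finset.univ, hs⟩
  rw [Finset.prod_pow] at this
  exact eq_frac_iff.mpr this

end Inverses

theorem exists_eq_add_single {ι : Type*} [DecidableEq ι] {b : ι → ℕ} {i : ι} (hi : b i ≠ 0) :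
    ∃ b' : ι → ℕ, b = b' + Pi.single i 1 := by
  refine ⟨b - Pi.single i 1, (tsub_add_cancel_of_le fun j => ?_).symm⟩
  by_cases hj : j = i
  · subst hj
    rw [Pi.single_eq_same]
    exact Nat.one_le_iff_ne_zero.mpr hi
  · rw [Pi.single_eq_of_ne hj]
    exact Nat.zero_le _

section ResidueLinear

open MvPolynomial CechTerm CechCochain

variable {A : Type*} [CommRing A] {n : ℕ} (f : MvPolynomial (Fin (n + 1)) A)

theorem residue_tmul_one_smul (r : Hypersurface f) (x : CechCochain (diagS f) (n + 1)) :
    residue f ((r ⊗ₜ 1 : Hypersurface f ⊗[A] MvPolynomial (Fin (n + 1)) A) • x) =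
      r * residue f x := by
  obtain ⟨N, p, rfl⟩ := exists_eq_topCochain f x
  rw [smul_topCochain, residue_topCochain, residue_topCochain, topCoeff_tmul_one_mul]

theorem residue_invMonomial (a : Fin (n + 1) → ℕ) :
    residue f (invMonomial (diagS f) a) = if a = 1 then 1 else 0 := by
  let N := ∑ i, a i
  have hN : ∀ i, a i ≤ N := fun i =>
    Finset.single_le_sum (f := a) (fun _ _ => Nat.zero_le _) (Finset.mem_univ i)
  rw [invMonomial_eq_ofFrac (diagS f) (N := N + 1) fun i => (hN i).trans (Nat.le_succ N),
    ofFrac_eq_topCochain, residue_topCochain, topCoeff_prod_pow]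
  refine if_congr ⟨fun h => ?_, fun h => ?_⟩ rfl rfl
  · funext i
    have h1 := congrFun h i
    have h2 := hN i
    simp only [Pi.one_apply] at h1 ⊢
    omega
  · funext i
    rw [h, Pi.one_apply, Nat.add_sub_cancel]

/-- Write `t^{-a} = ∏_i (y_i - x_i)^{-a_i}`. If all `a_i + b_i` are positive, the residue of
`t^{-a} δ(r t^{-b})` is that of `δ(r) t^{-a-b}`. The reason is that `[t_i, δ] = -[x_i, δ]`, so that
`t^{-a} δ(r t^{-b}) = t^{-a-e_i} δ(r t^{-b+e_i}) - t^{-a-e_i} [x_i, δ](r t^{-b})`; by induction on the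
order of `δ` the last term has no residue, since `a_i + 1 + b_i ≥ 2`. -/
theorem residue_invMonomial_mul_smul (k : ℕ) :
    ∀ (δ : diffOps A (Hypersurface f) (Hypersurface f)), OrderLT (Hypersurface f) k δ.1 →
      ∀ (r : Hypersurface f) (d : ℕ) (a b : Fin (n + 1) → ℕ), ∑ i, b i = d →
        (∀ i, 1 ≤ a i + b i) →
        residue f (invMonomial (diagS f) a *
          (δ • ((r ⊗ₜ 1 : Hypersurface f ⊗[A] MvPolynomial (Fin (n + 1)) A) •
            invMonomial (diagS f) b))) = if a + b = 1 then δ.1 r else 0 := by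
  induction k with
  | zero =>
    intro δ hδ r d a b _ _
    obtain rfl : δ = 0 := Subtype.ext hδ
    rw [zero_smul, mul_zero, map_zero]
    exact (ite_self _).symm
  | succ k ih =>
    intro δ hδ r d
    induction d with
    | zero =>
      intro a b hb _
      obtain rfl : b = 0 := funext fun i => (Finset.sum_eq_zero_iff.mp hb) i (Finset.mem_univ i)
      have h1 : δ • ((r ⊗ₜ 1 : Hypersurface f ⊗[A] MvPolynomial (Fin (n + 1)) A) •
          (1 : CechCochain (diagS f) (n + 1))) =
          (δ.1 r ⊗ₜ 1 : Hypersurface f ⊗[A] MvPolynomial (Fin (n + 1)) A) •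
            (1 : CechCochain (diagS f) (n + 1)) := by
        rw [smul_one_eq_algebraMap, smul_one_eq_algebraMap]
        exact funext fun s => smul_algebraMap_tmul (diagS f) s.1 δ r 1
      rw [invMonomial_zero, h1, invMonomial_mul_smul_one, residue_tmul_one_smul,
        residue_invMonomial, add_zero, mul_ite, mul_one, mul_zero]
    | succ d ihd =>
      intro a b hb hab
      obtain ⟨i, hi⟩ : ∃ i, b i ≠ 0 := by
        by_contra! h
        simp [h] at hb
      obtain ⟨b, rfl⟩ := exists_eq_add_single hi
      have hcomm := one_tmul_sub_tmul_one_smul δ (coord f i) (X i)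
        ((r ⊗ₜ 1 : Hypersurface f ⊗[A] MvPolynomial (Fin (n + 1)) A) •
            invMonomial (diagS f) (b + Pi.single i 1))
      have hd : ((1 : Hypersurface f) ⊗ₜ[A] X i - coord f i ⊗ₜ[A] 1) = diagS f i := rfl
      rw [hd, smul_smul_invMonomial_add_single] at hcomm
      have hsum : ∑ j, b j = d := by
        simp only [Pi.add_apply, Finset.sum_add_distrib, Finset.sum_pi_single', Finset.mem_univ,
          if_true] at hb
        omega
      rw [invMonomial_mul_of_smul_eq_sub (diagS f) a i hcomm, _root_.map_sub,
        ihd (a + Pi.single i 1) b hsum fun j => by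
          have := hab j
          simp only [Pi.add_apply] at this ⊢
          omega,
        ih (bracket (coord f i) δ) (hδ (coord f i)) r (d + 1) (a + Pi.single i 1) _ hb fun j => by
          have := hab j
          simp only [Pi.add_apply] at this ⊢
          omega,
        if_neg (c := a + Pi.single i 1 + (b + Pi.single i 1) = 1), sub_zero]
      · refine if_congr ?_ rfl rfl
        rw [add_assoc, add_comm (Pi.single i 1) b]
      · intro h
        have := congrFun h i
        simp only [Pi.add_apply, Pi.single_eq_same, Pi.one_apply] at this
        omega

theorem exists_one_tmul_eq (g : MvPolynomial (Fin (n + 1)) A) :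
    ∃ q : Fin (n + 1) → Hypersurface f ⊗[A] MvPolynomial (Fin (n + 1)) A,
      1 ⊗ₜ g = toHypersurface f g ⊗ₜ 1 + ∑ i, q i * diagS f i := by
  obtain ⟨q, hq⟩ := Ideal.mem_span_range_iff_exists_fun.mp (mem_span_diagS f g)
  exact ⟨q, by rw [hq, add_sub_cancel]⟩

/-- Cauchy's formula: the residue of `δ(g(y) / ∏_i (y_i - x_i))` is `δ(g(x))`. -/
theorem residue_smul_topCochain (δ : diffOps A (Hypersurface f) (Hypersurface f))
    (g : MvPolynomial (Fin (n + 1)) A) :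
    residue f ((1 ⊗ₜ g : Hypersurface f ⊗[A] MvPolynomial (Fin (n + 1)) A) •
      (δ • topCochain f 0 1)) = δ.1 (toHypersurface f g) := by
  obtain ⟨q, hq⟩ := exists_one_tmul_eq f g
  obtain ⟨v, hv⟩ := ofFrac_sum_eq_cechD (diagS f) 1 q
  simp only [pow_one] at hv
  have htop : topCochain f 0 (∑ i, q i * diagS f i) = cechD (diagS f) n v :=
    (ofFrac_eq_topCochain f 0 _).symm.trans hv
  have hone : topCochain f 0 (toHypersurface f g ⊗ₜ 1) =
      (toHypersurface f g ⊗ₜ 1 : Hypersurface f ⊗[A] MvPolynomial (Fin (n + 1)) A) •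
        invMonomial (diagS f) 1 := by
    rw [invMonomial_eq_ofFrac (diagS f) (a := 1) (N := 0 + 1) (fun _ => le_refl _),
      ofFrac_eq_topCochain, smul_topCochain]
    simp
  obtain ⟨k, hk⟩ := δ.2
  have hres := residue_invMonomial_mul_smul f k δ hk (toHypersurface f g) _ 0 1 rfl
    (fun _ => le_refl _)
  rw [invMonomial_zero, one_mul, zero_add, if_pos rfl, ← hone] at hres
  rw [one_tmul_smul_comm, smul_topCochain, mul_one, hq, topCochain_add, htop, smul_add, map_add,
    ← cechD_smul_diffOps, residue_cechD, add_zero, hres]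

end ResidueLinear

/-! ### From cohomology classes to differential operators -/

section KoszulOperators

open MvPolynomial

variable {A : Type*} [CommRing A] {n : ℕ} {f : MvPolynomial (Fin (n + 1)) A}

theorem exists_linearMap_eq_koszulOp {N : ℕ}
    {p : Hypersurface f ⊗[A] MvPolynomial (Fin (n + 1)) A}
    (h : ∀ g, koszulOp f N p (g * f) = 0) :
    ∃ δ : Hypersurface f →ₗ[A] Hypersurface f,
      ∀ g, δ (toHypersurface f g) = koszulOp f N p g := by
  let L : MvPolynomial (Fin (n + 1)) A →ₗ[A] Hypersurface f :=
    ((lcoeff (Hypersurface f) (Finsupp.equivFunOnFinite.symm fun _ => N)).restrictScalars A) ∘ₗ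
      ((taylor f).toLinearMap.restrictScalars A) ∘ₗ LinearMap.mulLeft A p ∘ₗ
        TensorProduct.mk A (Hypersurface f) (MvPolynomial (Fin (n + 1)) A) 1
  have hL : ∀ g, L g = koszulOp f N p g := fun _ => rfl
  let φ := (toHypersurface f).toLinearMap
  have hle : LinearMap.ker φ ≤ LinearMap.ker L := by
    intro g hg
    have hg' : g ∈ RingHom.ker (toHypersurface f) := hg
    rw [show RingHom.ker (toHypersurface f) = Ideal.span {f} from Ideal.Quotient.mkₐ_ker A _]
      at hg'
    obtain ⟨g', rfl⟩ := Ideal.mem_span_singleton'.mp hg'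
    rw [LinearMap.mem_ker, hL, h]
  refine ⟨(LinearMap.ker φ).liftQ L hle ∘ₗ
    (φ.quotKerEquivOfSurjective (toHypersurface_surjective f)).symm.toLinearMap, fun g => ?_⟩
  have e : (φ.quotKerEquivOfSurjective (toHypersurface_surjective f)).symm (toHypersurface f g) =
      Submodule.Quotient.mk g := by
    rw [LinearEquiv.symm_apply_eq]
    rfl
  rw [LinearMap.comp_apply, LinearEquiv.coe_coe, e, ← hL]
  rfl

theorem mul_koszulOp_sub (N : ℕ) (p : Hypersurface f ⊗[A] MvPolynomial (Fin (n + 1)) A)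
    (s g : MvPolynomial (Fin (n + 1)) A) :
    toHypersurface f s * koszulOp f N p g - koszulOp f N p (s * g) =
      koszulOp f N (p * -(1 ⊗ₜ s - toHypersurface f s ⊗ₜ 1)) g := by
  have e : (1 ⊗ₜ (s * g) : Hypersurface f ⊗[A] MvPolynomial (Fin (n + 1)) A) =
      1 ⊗ₜ s * 1 ⊗ₜ g := by rw [Algebra.TensorProduct.tmul_mul_tmul, one_mul]
  rw [koszulOp, koszulOp, koszulOp, ← topCoeff_tmul_one_mul, sub_eq_iff_eq_add, ← topCoeff_add, e]
  congr 1
  ring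

theorem mul_mem_pow_succ {T : Type*} [CommRing T] {I : Ideal T} {l : ℕ} {p q : T}
    (hp : p ∈ I ^ l) (hq : q ∈ I) : p * q ∈ I ^ (l + 1) := by
  rw [pow_succ]
  exact Ideal.mul_mem_mul hp hq

/-- Commutators with `s ∈ S` multiply `p` by elements of the ideal `I` of the diagonal. Since the
coefficient of `∏_i (y_i - x_i)^N` vanishes on `I^{(n+1)N+1}`, the operator has finite order. -/
theorem orderLT_of_eq_koszulOp {N : ℕ} (j : ℕ) :
    ∀ (l : ℕ) (p : Hypersurface f ⊗[A] MvPolynomial (Fin (n + 1)) A)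
      (δ : Hypersurface f →ₗ[A] Hypersurface f),
      p ∈ Ideal.span (Set.range (diagS f)) ^ l → (n + 1) * N < l + j →
      (∀ g, δ (toHypersurface f g) = koszulOp f N p g) → OrderLT (Hypersurface f) j δ := by
  induction j with
  | zero =>
    intro l p δ hp hl h
    refine LinearMap.ext fun x => ?_
    obtain ⟨g, rfl⟩ := toHypersurface_surjective f x
    rw [h, koszulOp, topCoeff_eq_zero_of_mem_pow f hl (Ideal.mul_mem_right _ _ hp),
      LinearMap.zero_apply]
  | succ j ih =>
    intro l p δ hp hl h t
    obtain ⟨s, rfl⟩ := toHypersurface_surjective f t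
    refine ih (l + 1) (p * -(1 ⊗ₜ s - toHypersurface f s ⊗ₜ 1)) _ ?_ (by omega) fun g => ?_
    · exact mul_mem_pow_succ hp (neg_mem (mem_span_diagS f s))
    · rw [commutator_apply, smul_eq_mul, smul_eq_mul, ← map_mul, h, h, mul_koszulOp_sub]

theorem ConnectsTo.exists_diffOps {c : CechCochain (diagR f) n} {N : ℕ}
    {p : Hypersurface f ⊗[A] MvPolynomial (Fin (n + 1)) A} (h : ConnectsTo f c N p) :
    ∃ δ : diffOps A (Hypersurface f) (Hypersurface f),
      ∀ g, δ.1 (toHypersurface f g) = koszulOp f N p g := by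
  obtain ⟨δ, hδ⟩ := exists_linearMap_eq_koszulOp h.koszulOp_mul_eq_zero
  refine ⟨⟨δ, (n + 1) * N + 1, ?_⟩, hδ⟩
  exact orderLT_of_eq_koszulOp _ 0 p δ (by simp) (by omega) hδ

variable (f) in
/-- There is a class corresponding to the identity operator: `f(y) / ∏_i (y_i - x_i)` is a
coboundary over `R ⊗ S`, as `f(y) = f(y) - f(x)` lies in the ideal of the diagonal. -/
theorem exists_connectsTo_one : ∃ c, ConnectsTo f c 0 1 := by
  obtain ⟨q, hq⟩ := exists_one_tmul_eq f f
  have hf0 : toHypersurface f f = 0 :=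
    Ideal.Quotient.eq_zero_iff_mem.mpr (Ideal.mem_span_singleton_self f)
  rw [hf0, TensorProduct.zero_tmul, zero_add] at hq
  obtain ⟨v, hv⟩ := exists_cechD_eq_topCochain f 0 q
  refine ⟨_, v, rfl, ?_⟩
  rw [← hv, smul_topCochain, mul_one, fy, hq]
  simp only [zero_add, pow_one]

/-- If `c` corresponds to the identity operator, `δ • c` corresponds to `δ`. -/
theorem ConnectsTo.exists_smul {c : CechCochain (diagR f) n} (h : ConnectsTo f c 0 1)
    (δ : diffOps A (Hypersurface f) (Hypersurface f)) :
    ∃ K q, ConnectsTo f (δ • c) K q ∧ ∀ g, koszulOp f K q g = δ.1 (toHypersurface f g) := by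
  obtain ⟨K, q, hc, hq⟩ := h.smul δ
  exact ⟨K, q, hc, fun g => by rw [koszulOp_eq_residue, hq, residue_smul_topCochain]⟩

theorem koszulOp_eq_of_sub_mem_cechCoboundaries
    (hfy : fy f ∈ nonZeroDivisors (Hypersurface f ⊗[A] MvPolynomial (Fin (n + 1)) A))
    {c d : CechCochain (diagR f) n} {N K : ℕ}
    {p q : Hypersurface f ⊗[A] MvPolynomial (Fin (n + 1)) A} (hc : ConnectsTo f c N p)
    (hd : ConnectsTo f d K q) (hcd : c - d ∈ cechCoboundaries (diagR f) n)
    (g : MvPolynomial (Fin (n + 1)) A) : koszulOp f N p g = koszulOp f K q g := by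
  obtain ⟨L, r, hr, h⟩ := hc.sub hd
  rw [← sub_eq_zero, ← h, hr.koszulOp_eq_zero_of_mem_cechCoboundaries hfy hcd]

end KoszulOperators

end HypersurfaceDiff
open HypersurfaceDiff in
theorem theorem1p2 {A : Type*} [CommRing A] (n : ℕ) (f : MvPolynomial (Fin (n + 1)) A)
    (hf : f ∈ nonZeroDivisors (MvPolynomial (Fin (n + 1)) A))
    (hfy : fy f ∈
      nonZeroDivisors (Hypersurface f ⊗[A] MvPolynomial (Fin (n + 1)) A)) :
    Ideal.span (Set.range (diagR f)) =
      RingHom.ker (Algebra.TensorProduct.lmul' A (S := Hypersurface f)) ∧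
    ∃ e : LocalCohomology (diagR f) n ≃ₗ[diffOps A (Hypersurface f) (Hypersurface f)]
        diffOps A (Hypersurface f) (Hypersurface f),
      ∀ c : cechCocycles (diagR f) n,
        (∃ N p, ConnectsTo f c.1 N p) ∧
        ∀ N p, ConnectsTo f c.1 N p → ∀ g : MvPolynomial (Fin (n + 1)) A,
          (e (Submodule.Quotient.mk c)).1 (toHypersurface f g) =
            koszulOp f N p g := by
  refine ⟨span_diagR_eq_ker_lmul' f, ?_⟩
  -- The inverse of `e` sends `δ` to `δ • η`, where `η` is the class with value the identity
  -- operator; defined this way, it is `D_{R|A}`-linear for free.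
  obtain ⟨η, hη⟩ := exists_connectsTo_one f
  let η' : cechCocycles (diagR f) n := ⟨η, hη.cechD_eq_zero⟩
  let Φ : diffOps A (Hypersurface f) (Hypersurface f) →ₗ[diffOps A (Hypersurface f)
      (Hypersurface f)] LocalCohomology (diagR f) n :=
    LinearMap.toSpanSingleton _ _ (Submodule.Quotient.mk η')
  have hΦ : ∀ δ (c : cechCocycles (diagR f) n), Φ δ = Submodule.Quotient.mk c ↔
      c.1 - δ • η ∈ cechCoboundaries (diagR f) n := by
    intro δ c
    have : Φ δ = Submodule.Quotient.mk (δ • η') := rfl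
    rw [this, eq_comm, Submodule.Quotient.eq]
    rfl
  have hval : ∀ δ (c : cechCocycles (diagR f) n), Φ δ = Submodule.Quotient.mk c →
      ∀ N p, ConnectsTo f c.1 N p → ∀ g, δ.1 (toHypersurface f g) = koszulOp f N p g := by
    intro δ c h N p hc g
    obtain ⟨K, q, hq, hδ⟩ := hη.exists_smul δ
    rw [← hδ]
    exact (koszulOp_eq_of_sub_mem_cechCoboundaries hfy hc hq ((hΦ δ c).mp h) g).symm
  have hbij : Function.Bijective Φ := by
    constructor
    · intro δ ε h
      obtain ⟨K, q, hq, hε⟩ := hη.exists_smul ε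
      refine Subtype.ext (LinearMap.ext fun x => ?_)
      obtain ⟨g, rfl⟩ := toHypersurface_surjective f x
      rw [hval δ (ε • η') h K q hq g, hε]
    · intro x
      obtain ⟨c, rfl⟩ := Submodule.Quotient.mk_surjective _ x
      obtain ⟨N, p, hc⟩ := exists_connectsTo (f := f) (c := c.1) c.2
      obtain ⟨δ, hδ⟩ := hc.exists_diffOps
      obtain ⟨K, q, hq, hδ'⟩ := hη.exists_smul δ
      refine ⟨δ, (hΦ δ c).mpr ?_⟩
      obtain ⟨L, r, hr, h⟩ := hc.sub hq
      exact hr.mem_cechCoboundaries_of_koszulOp_eq_zero fun g => by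
        rw [h, ← hδ, hδ', sub_self]
  refine ⟨(LinearEquiv.ofBijective Φ hbij).symm, fun c => ⟨exists_connectsTo c.2, ?_⟩⟩
  exact hval _ c ((LinearEquiv.ofBijective Φ hbij).apply_symm_apply _)
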